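/- Fix $0<q<1$. For a complex polynomial $f$ let $\breve f(w)=f\big(\tfrac12(w+w^{-1})\big)$, $w\in\mathbb C\setminus\{0\}$, and let $e(x)=x$. The Askey--Wilson operator $\mathcal D_q$ and the averaging operator $\mathcal S_q$ are the operators on $\mathbb C[z]$ given, for $z=\frac12(w+w^{-1})$, by $$\mathcal D_qf(z)=\frac{\breve f(q^{1/2}w)-\breve f(q^{-1/2}w)}{\breve e(q^{1/2}w)-\breve e(q^{-1/2}w)},\qquad \mathcal S_qf(z)=\frac{\breve f(q^{1/2}w)+\breve f(q^{-1/2}w)}{2}.$$ For $n\in\mathbb Z$ put $\alpha_n=\frac12(q^{n/2}+q^{-n/2})$, $\gamma_n=\dfrac{q^{n/2}-q^{-n/2}}{q^{1/2}-q^{-1/2}}$ and $\alpha=\alpha_1$. Let $(P_n)_{n\ge0}$ be a monic orthogonal polynomial sequence with respect to a linear functional ${\bf u}$ on $\mathbb C[z]$ (that is, $\deg P_n=n$, $\langle {\bf u},P_mP_n\rangle=0$ for $m\ne n$ and $\langle{\bf u},P_n^2\rangle\neq0$), with three-term recurrence relation $$P_{-1}=0,\qquad P_{n+1}(z)=(z-B_n)P_n(z)-C_nP_{n-1}(z),\quad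 C_n\neq0 .$$ Suppose that there are $a,b,c\in\mathbb C$ and complex sequences $(a_n),(b_n),(c_n)$ with $c_n\neq0$ for all $n\ge 0$, such that $$(az^2+bz+c)\,\mathcal D_qP_n(z)=a_n\mathcal S_qP_{n+1}(z)+b_n\mathcal S_qP_n(z)+c_n\mathcal S_qP_{n-1}(z)\qquad(n=0,1,\ldots).$$ Put $r_i=c_i+2aC_i$ ($i=2,3$). Suppose that, if $a\neq0$, $$(4\alpha^2-1)aC_2C_3+\frac{r_3}{2}\Big[(B_0+B_1)^2+4\alpha^2(C_1-B_0B_1+\alpha^2-1)-2(2\alpha^2-1)C_2\Big]=0,$$ and that (whether or not $a=0$) $$aC_2C_3\Big(b_2+2aB_2+\frac b\alpha\Big)-r_3\Big(a(B_2+B_1)C_2+\frac b\alpha C_2-\frac{r_2}{2}(B_1-B_0)\Big)=0 .$$ Then $(P_n)$ are Askey--Wilson polynomials, or special or limiting cases of them, in the following sense. For complex $t_1,t_2,t_3,t_4$ with $t_1\neq0$ and $t_1t_2t_3t_4q^n\ne1$, $t_it_jq^n\neq1$ for all $n\ge0$ and $1\le i<j\le4$, let $Q_n(\cdot;t_1,t_2,t_3,t_4|q)$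 be the monic Askey--Wilson polynomial of degree $n$, $$Q_n(\cos\theta;t_1,t_2,t_3,t_4|q)=\frac{(t_1t_2,t_1t_3,t_1t_4;q)_n}{(2t_1)^n(t_1t_2t_3t_4q^{n-1};q)_n}\sum_{k=0}^n\frac{(q^{-n},t_1t_2t_3t_4q^{n-1},t_1e^{i\theta},t_1e^{-i\theta};q)_k}{(t_1t_2,t_1t_3,t_1t_4,q;q)_k}q^k ,$$ where $(x;q)_k=\prod_{j=0}^{k-1}(1-xq^j)$ and $(x_1,\ldots,x_m;q)_k=\prod_{i=1}^m(x_i;q)_k$. Then there are parameters $t_1^{(k)},\ldots,t_4^{(k)}$ ($k=0,1,\ldots$) satisfying these restrictions such that, for every $n$, $Q_n(\cdot;t_1^{(k)},t_2^{(k)},t_3^{(k)},t_4^{(k)}|q)\to P_n$ coefficientwise as $k\to\infty$ (constant parameters give the Askey--Wilson polynomials themselves). Moreover $r_3\neq0$, and for every $n\ge0$ the polynomial $Y=P_n$ satisfies $$\phi(z)\,\mathcal D_q^2Y+\psi(z)\,\mathcal S_q\mathcal D_qY=\lambda_nY,$$ with $\phi(z)=\mathfrak a z^2+\mathfrak b z+\mathfrak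 c$, $\psi(z)=z-B_0$, $\lambda_n=\gamma_n(\mathfrak a\gamma_{n-1}+\alpha_{n-1})$ and $$\mathfrak a=-\frac{aC_3+(\alpha^2-1)r_3}{\alpha r_3},\qquad \mathfrak b=-\frac1{2\alpha}\Big(\Big(1-2a\frac{C_3}{r_3}\Big)(B_0+B_1)-2\alpha^2B_0\Big),$$ $$\mathfrak c=-\frac1{2\alpha}\Big(\Big(1-2a\frac{C_3}{r_3}\Big)(C_1-B_0B_1)+C_1+B_0^2\Big).$$ -/

import Mathlib

open Polynomial

namespace AskeyWilson

/-- `qPow q t` is the real power `q ^ t` of a positive real `q`, as a complex number. -/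
noncomputable def qPow (q t : ℝ) : ℂ := ((q ^ t : ℝ) : ℂ)

/-- For a polynomial `f`, the function `f̆` with `f̆ (e^{iθ}) = f (cos θ)`, that is
`f̆ (w) = f ((w + 1/w)/2)`, for every nonzero complex number `w`. -/
noncomputable def breve (f : ℂ[X]) (w : ℂ) : ℂ := f.eval ((w + w⁻¹) / 2)

/-- `g` is the result of applying the Askey-Wilson operator to `f`:
`f̆(q^{1/2} w) - f̆(q^{-1/2} w) = ğ(w) (ĕ(q^{1/2} w) - ĕ(q^{-1/2} w))`, where `e(x) = x`. -/
def IsDivDiff (q : ℝ) (f g : ℂ[X]) : Prop :=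
  ∀ w : ℂ, w ≠ 0 →
    breve f (qPow q (1 / 2) * w) - breve f (qPow q (-(1 / 2)) * w) =
      breve g w * (breve X (qPow q (1 / 2) * w) - breve X (qPow q (-(1 / 2)) * w))

/-- `g` is the result of applying the averaging operator to `f`:
`ğ(w) = (f̆(q^{1/2} w) + f̆(q^{-1/2} w)) / 2`. -/
def IsAverage (q : ℝ) (f g : ℂ[X]) : Prop :=
  ∀ w : ℂ, w ≠ 0 →
    breve g w = (breve f (qPow q (1 / 2) * w) + breve f (qPow q (-(1 / 2)) * w)) / 2

/-- The Askey-Wilson operator `𝒟_q` on polynomials: `Dq q f` is the unique polynomial with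
`IsDivDiff q f (Dq q f)`; see `isDivDiff_Dq` and `IsDivDiff.unique`. -/
noncomputable def Dq (q : ℝ) (f : ℂ[X]) : ℂ[X] :=
  Classical.epsilon (fun g : ℂ[X] => IsDivDiff q f g)

/-- The averaging operator `𝒮_q` on polynomials: `Sq q f` is the unique polynomial with
`IsAverage q f (Sq q f)`; see `isAverage_Sq` and `IsAverage.unique`. -/
noncomputable def Sq (q : ℝ) (f : ℂ[X]) : ℂ[X] :=
  Classical.epsilon (fun g : ℂ[X] => IsAverage q f g)

theorem qPow_ne_zero {q : ℝ} (hq : 0 < q) (t : ℝ) : qPow q t ≠ 0 := by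
  unfold qPow
  exact_mod_cast (Real.rpow_pos_of_pos hq t).ne'

theorem qPow_neg {q : ℝ} (hq : 0 < q) (t : ℝ) : qPow q (-t) = (qPow q t)⁻¹ := by
  unfold qPow
  rw [Real.rpow_neg hq.le]
  push_cast
  rfl

theorem exists_divDiff_average {q : ℝ} (hq : 0 < q) (f : ℂ[X]) :
    (∃ g, IsDivDiff q f g) ∧ (∃ g, IsAverage q f g) := by
  have hp := qPow_ne_zero hq (1 / 2)
  have hm := qPow_neg hq (1 / 2)
  induction f using Polynomial.induction_on' with
  | add p r hp hr =>
    obtain ⟨⟨g₁, h₁⟩, ⟨k₁, l₁⟩⟩ := hp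
    obtain ⟨⟨g₂, h₂⟩, ⟨k₂, l₂⟩⟩ := hr
    refine ⟨⟨g₁ + g₂, fun w hw => ?_⟩, ⟨k₁ + k₂, fun w hw => ?_⟩⟩
    · have e₁ := h₁ w hw
      have e₂ := h₂ w hw
      simp only [breve, eval_add] at e₁ e₂ ⊢
      linear_combination e₁ + e₂
    · have e₁ := l₁ w hw
      have e₂ := l₂ w hw
      simp only [breve, eval_add] at e₁ e₂ ⊢
      linear_combination e₁ + e₂
  | monomial n a =>
    induction n with
    | zero =>
      refine ⟨⟨0, fun w hw => by simp [breve]⟩, ⟨C a, fun w hw => by simp [breve]⟩⟩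
    | succ n ih =>
      obtain ⟨⟨g, hg⟩, ⟨k, hk⟩⟩ := ih
      set s := qPow q (1 / 2) with hs
      refine ⟨⟨k + C ((s + s⁻¹) / 2) * X * g, fun w hw => ?_⟩,
        ⟨C ((s - s⁻¹) ^ 2 / 4) * (X ^ 2 - 1) * g + C ((s + s⁻¹) / 2) * X * k, fun w hw => ?_⟩⟩
      · have e₁ := hg w hw
        have e₂ := hk w hw
        rw [hm, ← hs] at *
        simp only [breve, eval_add, eval_mul, eval_monomial, eval_C, eval_X, pow_succ] at *
        rw [e₂]
        have hsw : (s * w + (s * w)⁻¹) / 2 + (s⁻¹ * w + (s⁻¹ * w)⁻¹) / 2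
            = 2 * ((s + s⁻¹) / 2 * ((w + w⁻¹) / 2)) := by
          field_simp
          ring
        linear_combination ((s * w + (s * w)⁻¹) / 2 + (s⁻¹ * w + (s⁻¹ * w)⁻¹) / 2) / 2 * e₁
          + (eval ((w + w⁻¹) / 2) g * ((s * w + (s * w)⁻¹) / 2 - (s⁻¹ * w + (s⁻¹ * w)⁻¹) / 2)) / 2
            * hsw
      · have e₁ := hg w hw
        have e₂ := hk w hw
        rw [hm, ← hs] at *
        simp only [breve, eval_add, eval_mul, eval_monomial, eval_C, eval_X, pow_succ, eval_sub,
          eval_pow, eval_one] at *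
        rw [e₂]
        have hsw : (s * w + (s * w)⁻¹) / 2 + (s⁻¹ * w + (s⁻¹ * w)⁻¹) / 2
            = 2 * ((s + s⁻¹) / 2 * ((w + w⁻¹) / 2)) := by
          field_simp
          ring
        have hdw : ((s * w + (s * w)⁻¹) / 2 - (s⁻¹ * w + (s⁻¹ * w)⁻¹) / 2) ^ 2
            = 4 * ((s - s⁻¹) ^ 2 / 4 * (((w + w⁻¹) / 2) ^ 2 - 1)) := by
          field_simp
          ring
        linear_combination
          (-((s * w + (s * w)⁻¹) / 2 - (s⁻¹ * w + (s⁻¹ * w)⁻¹) / 2) / 4) * e₁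
          - (eval ((w + w⁻¹) / 2) g) / 4 * hdw
          - (a * ((s * w + (s * w)⁻¹) / 2) ^ n + a * ((s⁻¹ * w + (s⁻¹ * w)⁻¹) / 2) ^ n) / 4 * hsw

theorem isDivDiff_Dq {q : ℝ} (hq : 0 < q) (f : ℂ[X]) : IsDivDiff q f (Dq q f) :=
  Classical.epsilon_spec (exists_divDiff_average hq f).1

theorem isAverage_Sq {q : ℝ} (hq : 0 < q) (f : ℂ[X]) : IsAverage q f (Sq q f) :=
  Classical.epsilon_spec (exists_divDiff_average hq f).2

theorem eq_of_breve_eq {g h : ℂ[X]}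
    (H : ∀ w : ℂ, w ≠ 0 → w ^ 2 ≠ 1 → breve g w = breve h w) : g = h := by
  apply Polynomial.eq_of_infinite_eval_eq
  have hinj : Function.Injective (fun n : ℕ => (((n : ℂ) + 2) + ((n : ℂ) + 2)⁻¹) / 2) := by
    intro m n hmn
    have hm : ((m : ℂ) + 2) ≠ 0 := by exact_mod_cast Nat.succ_ne_zero (m + 1)
    have hn : ((n : ℂ) + 2) ≠ 0 := by exact_mod_cast Nat.succ_ne_zero (n + 1)
    have h1 : ((m : ℂ) - n) * (((m : ℂ) + 2) * ((n : ℂ) + 2) - 1) = 0 := by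
      simp only at hmn
      field_simp at hmn
      linear_combination hmn
    rcases mul_eq_zero.1 h1 with h | h
    · exact_mod_cast sub_eq_zero.1 h
    · exfalso
      have h2 : (((m + 2) * (n + 2) : ℕ) : ℂ) = ((1 : ℕ) : ℂ) := by
        push_cast
        linear_combination h
      have h3 : (m + 2) * (n + 2) = 1 := by exact_mod_cast h2
      nlinarith
  refine (Set.infinite_range_of_injective hinj).mono ?_
  rintro _ ⟨n, rfl⟩
  have hn : ((n : ℂ) + 2) ≠ 0 := by exact_mod_cast Nat.succ_ne_zero (n + 1)
  refine H ((n : ℂ) + 2) hn ?_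
  intro h
  have h2 : (((n + 2) ^ 2 : ℕ) : ℂ) = ((1 : ℕ) : ℂ) := by
    push_cast
    exact h
  have h3 : (n + 2) ^ 2 = 1 := by exact_mod_cast h2
  have h4 : 2 ^ 2 ≤ (n + 2) ^ 2 := Nat.pow_le_pow_left (by omega) 2
  omega

theorem IsDivDiff.unique {q : ℝ} (hq0 : 0 < q) (hq1 : q < 1) {f g h : ℂ[X]}
    (hg : IsDivDiff q f g) (hh : IsDivDiff q f h) : g = h := by
  refine eq_of_breve_eq fun w hw hw2 => ?_
  have e := (hg w hw).symm.trans (hh w hw)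
  refine mul_right_cancel₀ ?_ e
  have hp := qPow_ne_zero hq0 (1 / 2)
  rw [qPow_neg hq0]
  have hs2 : (qPow q (1 / 2)) ^ 2 ≠ 1 := by
    unfold qPow
    rw [← Complex.ofReal_pow, ← Real.rpow_natCast, ← Real.rpow_mul hq0.le]
    norm_num
    exact_mod_cast hq1.ne
  generalize qPow q (1 / 2) = s at *
  simp only [breve, eval_X]
  have : (s * w + (s * w)⁻¹) / 2 - (s⁻¹ * w + (s⁻¹ * w)⁻¹) / 2
      = (s ^ 2 - 1) * (w ^ 2 - 1) / (2 * s * w) := by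
    field_simp
    ring
  rw [this]
  have h1 := sub_ne_zero.2 hs2
  have h2 := sub_ne_zero.2 hw2
  exact div_ne_zero (mul_ne_zero h1 h2) (mul_ne_zero (mul_ne_zero two_ne_zero hp) hw)

theorem IsAverage.unique {q : ℝ} {f g h : ℂ[X]}
    (hg : IsAverage q f g) (hh : IsAverage q f h) : g = h :=
  eq_of_breve_eq fun w hw _ => (hg w hw).trans (hh w hw).symm

/-- `α_n = (q^{n/2} + q^{-n/2}) / 2` for every integer `n`; in particular `α_{-1} = α_1 = α`. -/
noncomputable def alphaNum (q : ℝ) (n : ℤ) : ℂ :=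
  (qPow q ((n : ℝ) / 2) + qPow q (-((n : ℝ) / 2))) / 2

/-- `γ_n = (q^{n/2} - q^{-n/2}) / (q^{1/2} - q^{-1/2})` for every integer `n`;
in particular `γ_{-1} = -1`. -/
noncomputable def gammaNum (q : ℝ) (n : ℤ) : ℂ :=
  (qPow q ((n : ℝ) / 2) - qPow q (-((n : ℝ) / 2))) / (qPow q (1 / 2) - qPow q (-(1 / 2)))

/-- `P` is a monic orthogonal polynomial sequence with respect to the linear functional `u`. -/
structure IsMonicOPS (u : ℂ[X] →ₗ[ℂ] ℂ) (P : ℕ → ℂ[X]) : Prop where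
  monic : ∀ n, (P n).Monic
  natDegree_eq : ∀ n, (P n).natDegree = n
  orthogonal : ∀ m n, m ≠ n → u (P m * P n) = 0
  regular : ∀ n, u (P n * P n) ≠ 0

/-- The sequence `n ↦ P_{n-1}`, with `P_{-1} = 0`. -/
noncomputable def prev (P : ℕ → ℂ[X]) : ℕ → ℂ[X]
  | 0 => 0
  | n + 1 => P n

/-- The coefficient `B_n` in `P_{n+1} = (z - B_n) P_n - C_n P_{n-1}`;
see `IsMonicOPS.recurrence`. -/
noncomputable def recB (u : ℂ[X] →ₗ[ℂ] ℂ) (P : ℕ → ℂ[X]) (n : ℕ) : ℂ :=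
  u (X * P n * P n) / u (P n * P n)

/-- The coefficient `C_n` in `P_{n+1} = (z - B_n) P_n - C_n P_{n-1}` for `n ≥ 1`;
see `IsMonicOPS.recurrence`. The value at `0` is immaterial, since `P_{-1} = 0`. -/
noncomputable def recC (u : ℂ[X] →ₗ[ℂ] ℂ) (P : ℕ → ℂ[X]) : ℕ → ℂ
  | 0 => 1
  | n + 1 => u (P (n + 1) * P (n + 1)) / u (P n * P n)

theorem IsMonicOPS.apply_mul_eq_zero {u : ℂ[X] →ₗ[ℂ] ℂ} {P : ℕ → ℂ[X]} (hP : IsMonicOPS u P)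
    (n : ℕ) : ∀ (d : ℕ) (f : ℂ[X]), d ≤ n → (∀ i, d ≤ i → f.coeff i = 0) → u (f * P n) = 0 := by
  intro d
  induction d with
  | zero =>
    intro f _ hf
    have : f = 0 := by
      ext i
      simpa using hf i (Nat.zero_le i)
    simp [this]
  | succ d ih =>
    intro f hd hf
    have h1 := ih (f - C (f.coeff d) * P d) (by omega) (by
      intro i hi
      rcases hi.eq_or_lt with rfl | hi
      · have := hP.monic d
        rw [Monic, leadingCoeff, hP.natDegree_eq] at this
        simp [this]
      · have h2 : (P d).coeff i = 0 := by
          apply coeff_eq_zero_of_natDegree_lt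
          rw [hP.natDegree_eq]
          exact hi
        simp [h2, hf i hi])
    have h3 : f * P n = (f - C (f.coeff d) * P d) * P n + f.coeff d • (P d * P n) := by
      rw [smul_eq_C_mul]
      ring
    rw [h3, map_add, h1, map_smul, hP.orthogonal d n (by omega)]
    simp

/-- An orthogonal functional detects zero among polynomials of bounded degree. -/
theorem IsMonicOPS.eq_zero_of_forall {u : ℂ[X] →ₗ[ℂ] ℂ} {P : ℕ → ℂ[X]} (hP : IsMonicOPS u P) :
    ∀ (d : ℕ) (f : ℂ[X]), (∀ i, d ≤ i → f.coeff i = 0) → (∀ m, m < d → u (f * P m) = 0) →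
      f = 0 := by
  intro d
  induction d with
  | zero =>
    intro f hf _
    ext i
    simpa using hf i (Nat.zero_le i)
  | succ d ih =>
    intro f hf hu
    have hlead : (P d).coeff d = 1 := by
      have := hP.monic d
      rwa [Monic, leadingCoeff, hP.natDegree_eq] at this
    have hg : ∀ i, d ≤ i → (f - C (f.coeff d) * P d).coeff i = 0 := by
      intro i hi
      rcases hi.eq_or_lt with rfl | hi
      · simp [hlead]
      · have h2 : (P d).coeff i = 0 := by
          apply coeff_eq_zero_of_natDegree_lt
          rw [hP.natDegree_eq]
          exact hi
        simp [h2, hf i hi]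
    have h1 := hP.apply_mul_eq_zero d d _ le_rfl hg
    have h3 : f * P d = (f - C (f.coeff d) * P d) * P d + f.coeff d • (P d * P d) := by
      rw [smul_eq_C_mul]
      ring
    have h4 := hu d (Nat.lt_succ_self d)
    rw [h3, map_add, h1, map_smul, zero_add, smul_eq_mul] at h4
    have h5 : f.coeff d = 0 := (mul_eq_zero.1 h4).resolve_right (hP.regular d)
    refine ih f ?_ (fun m hm => hu m (by omega))
    intro i hi
    rcases hi.eq_or_lt with rfl | hi
    · exact h5
    · exact hf i hi

/-- The three-term recurrence relation, with nonzero `C_n`. -/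
theorem IsMonicOPS.recurrence {u : ℂ[X] →ₗ[ℂ] ℂ} {P : ℕ → ℂ[X]} (hP : IsMonicOPS u P) (n : ℕ) :
    P (n + 1) = (X - C (recB u P n)) * P n - C (recC u P n) * prev P n ∧ recC u P n ≠ 0 := by
  have hlead : ∀ d, (P d).coeff d = 1 := by
    intro d
    have := hP.monic d
    rwa [Monic, leadingCoeff, hP.natDegree_eq] at this
  have hzero : ∀ d i, d < i → (P d).coeff i = 0 := by
    intro d i hi
    apply coeff_eq_zero_of_natDegree_lt
    rw [hP.natDegree_eq]
    exact hi
  refine ⟨?_, ?_⟩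
  · rw [← sub_eq_zero]
    refine hP.eq_zero_of_forall (n + 1) _ ?_ ?_
    · intro i hi
      have hprev : (prev P n).coeff i = 0 := by
        cases n with
        | zero => simp [prev]
        | succ k => exact hzero k i (by omega)
      obtain ⟨j, rfl⟩ : ∃ j, i = j + 1 := ⟨i - 1, by omega⟩
      rw [sub_mul]
      simp only [coeff_sub, coeff_C_mul, hprev, coeff_X_mul, hzero n (j + 1) (by omega)]
      rcases hi.eq_or_lt with h | h
      · obtain rfl : n = j := by omega
        simp [hlead]
      · simp [hzero (n + 1) (j + 1) h, hzero n j (by omega)]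
    · intro m hm
      have e : (P (n + 1) - ((X - C (recB u P n)) * P n - C (recC u P n) * prev P n)) * P m
          = P (n + 1) * P m - X * P n * P m + recB u P n • (P n * P m)
            + recC u P n • (prev P n * P m) := by
        rw [smul_eq_C_mul, smul_eq_C_mul]
        ring
      rw [e, map_add, map_add, map_sub, map_smul, map_smul, hP.orthogonal (n + 1) m (by omega)]
      rcases (Nat.lt_succ_iff.1 hm).eq_or_lt with rfl | hmn
      · have hprev : u (prev P m * P m) = 0 := by
          cases m with
          | zero => simp [prev]
          | succ k => exact hP.orthogonal k (k + 1) (by omega)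
        have := hP.regular m
        rw [hprev, recB]
        simp only [smul_eq_mul]
        field_simp
        ring
      · obtain ⟨k, rfl⟩ : ∃ k, n = k + 1 := ⟨n - 1, by omega⟩
        rw [hP.orthogonal (k + 1) m (by omega)]
        simp only [prev, recC, smul_eq_mul]
        rcases (Nat.lt_succ_iff.1 hmn).eq_or_lt with rfl | hmk
        · have h0 : u ((X * P m - P (m + 1)) * P (m + 1)) = 0 := by
            refine hP.apply_mul_eq_zero (m + 1) (m + 1) _ le_rfl ?_
            intro i hi
            obtain ⟨j, rfl⟩ : ∃ j, i = j + 1 := ⟨i - 1, by omega⟩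
            rcases hi.eq_or_lt with h | h
            · obtain rfl : m = j := by omega
              simp [hlead]
            · simp [hzero (m + 1) (j + 1) h, hzero m j (by omega)]
          have e2 : X * P (m + 1) * P m
              = (X * P m - P (m + 1)) * P (m + 1) + P (m + 1) * P (m + 1) := by
            ring
          have := hP.regular m
          rw [e2, map_add, h0]
          field_simp
          ring
        · have h0 : u (X * P m * P (k + 1)) = 0 := by
            refine hP.apply_mul_eq_zero (k + 1) (m + 2) _ (by omega) ?_
            intro i hi
            obtain ⟨j, rfl⟩ : ∃ j, i = j + 1 := ⟨i - 1, by omega⟩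
            simp [hzero m j (by omega)]
          have e2 : X * P (k + 1) * P m = X * P m * P (k + 1) := by ring
          rw [e2, h0, hP.orthogonal k m (by omega)]
          ring
  · cases n with
    | zero => simp [recC]
    | succ k => exact div_ne_zero (hP.regular _) (hP.regular _)

/-- The `q`-shifted factorial `(x; q)_n`. -/
noncomputable def qPoch (x q : ℂ) (n : ℕ) : ℂ := ∏ j ∈ Finset.range n, (1 - x * q ^ j)

/-- The monic Askey-Wilson polynomial `Q_n(z; a₁, a₂, a₃, a₄ | q)` of degree `n`: the
`₄φ₃`-representation, divided by its leading coefficient. With `z = cos θ`, the last product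
is `(a₁ e^{iθ}, a₁ e^{-iθ}; q)_k`. -/
noncomputable def askeyWilsonPoly (q a₁ a₂ a₃ a₄ : ℂ) (n : ℕ) : ℂ[X] :=
  C (qPoch (a₁ * a₂) q n * qPoch (a₁ * a₃) q n * qPoch (a₁ * a₄) q n /
      ((2 * a₁) ^ n * qPoch (a₁ * a₂ * a₃ * a₄ * q ^ ((n : ℤ) - 1)) q n)) *
    ∑ k ∈ Finset.range (n + 1),
      C (qPoch (q ^ (-(n : ℤ))) q k * qPoch (a₁ * a₂ * a₃ * a₄ * q ^ ((n : ℤ) - 1)) q k /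
          (qPoch (a₁ * a₂) q k * qPoch (a₁ * a₃) q k * qPoch (a₁ * a₄) q k * qPoch q q k) *
          q ^ k) *
        ∏ j ∈ Finset.range k, (1 - C (2 * a₁ * q ^ j) * X + C (a₁ ^ 2 * q ^ (2 * j)))

/-- The restrictions on the parameters under which the Askey-Wilson polynomials form an
orthogonal polynomial sequence (and `a₁ ≠ 0`, for the representation above). -/
def AdmissibleParams (q a₁ a₂ a₃ a₄ : ℂ) : Prop :=
  a₁ ≠ 0 ∧ ∀ n : ℕ,
    (1 - a₁ * a₂ * a₃ * a₄ * q ^ n) * (1 - a₁ * a₂ * q ^ n) * (1 - a₁ * a₃ * q ^ n) *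
      (1 - a₁ * a₄ * q ^ n) * (1 - a₂ * a₃ * q ^ n) * (1 - a₂ * a₄ * q ^ n) *
      (1 - a₃ * a₄ * q ^ n) ≠ 0

/-- The sequence `P` of monic polynomials consists of Askey-Wilson polynomials, or of a special
or limiting case of them (same base `q`, same variable): there are admissible parameters
`a₁(k), …, a₄(k)` such that for every `n`, the polynomials `Q_n(·; a₁(k), …, a₄(k) | q)`
converge to `P n` coefficientwise as `k → ∞`. Constant parameters give the Askey-Wilson
polynomials themselves. -/
def IsAskeyWilsonOrLimit (q : ℝ) (P : ℕ → ℂ[X]) : Prop :=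
  ∃ a₁ a₂ a₃ a₄ : ℕ → ℂ,
    (∀ k, AdmissibleParams (q : ℂ) (a₁ k) (a₂ k) (a₃ k) (a₄ k)) ∧
    ∀ n i : ℕ, Filter.Tendsto
      (fun k => (askeyWilsonPoly (q : ℂ) (a₁ k) (a₂ k) (a₃ k) (a₄ k) n).coeff i)
      Filter.atTop (nhds ((P n).coeff i))

end AskeyWilson

open AskeyWilson

namespace AskeyWilson

/-! ### Basic properties of the operators -/

/-! The structure relation forces a Pearson equation on the functional: `u (φ 𝒟f + ψ 𝒮f) = 0` for
all `f`, with `ψ = P 1`. To obtain it, note that `𝒮` multiplies leading coefficients by `α_n ≠ 0`,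
so it is injective and every functional has the form `f ↦ v (𝒮f)`. Take `v` with `v (𝒮f) = u (ρ f)`
for a suitable `ρ` in the span of `P 0, P 1, P 2`, and apply `v` to the structure relation.
Orthogonality makes the resulting scalar identities automatic except for `n = 1, 2, 3`; these three
hold by the choice of `ρ` and the two compatibility conditions. They yield `v (𝒟f) = u (P 1 * f)`
(`pearson_of_structure`), and eliminating `v` gives the Pearson equation
(`apply_pearsonOp_eq_zero`).

For such `u` the operator `f ↦ φ 𝒟²f + ψ 𝒮𝒟f` is symmetric for the bilinear form `u (f g)` and does
not raise degrees, so each `P n` is an eigenpolynomial (`pearsonOp_Dq_eq`). Regularity of `u`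
excludes `𝔞 γ_n + α_n = 0` (`admissible_of_pearsonOp`), which makes the eigenvalues pairwise
distinct. A monic eigenpolynomial is then determined by the equation and depends continuously on its
coefficients (`tendsto_coeff_eigenpoly`).

The operator attached to four parameters is bidiagonal in the basis `(t₁w, t₁/w; q)_k`, so the `₄φ₃`
sums are its eigenpolynomials (`pearsonOp_Dq_askeyWilsonPoly`). The equations that come from
admissible parameters are dense among all `(𝔞, 𝔟, 𝔠, β)` (`mem_closure_paramRel`). Approximating the
equation of `P n` by such equations gives the limit statement. -/

theorem qPow_half_zpow {q : ℝ} (hq : 0 < q) (n : ℤ) :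
    qPow q ((n : ℝ) / 2) = qPow q (1 / 2) ^ n := by
  unfold qPow
  rw [← Complex.ofReal_zpow, ← Real.rpow_intCast, ← Real.rpow_mul hq.le]
  congr 2
  ring

theorem qPow_half_sq {q : ℝ} (hq : 0 < q) : qPow q (1 / 2) ^ 2 = (q : ℂ) := by
  unfold qPow
  rw [← Complex.ofReal_pow, ← Real.rpow_natCast, ← Real.rpow_mul hq.le]
  norm_num

theorem alphaNum_eq {q : ℝ} (hq : 0 < q) (n : ℤ) :
    alphaNum q n = (qPow q (1 / 2) ^ n + (qPow q (1 / 2) ^ n)⁻¹) / 2 := by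
  rw [alphaNum, qPow_neg hq, qPow_half_zpow hq]

theorem gammaNum_eq {q : ℝ} (hq : 0 < q) (n : ℤ) :
    gammaNum q n = (qPow q (1 / 2) ^ n - (qPow q (1 / 2) ^ n)⁻¹) /
      (qPow q (1 / 2) - (qPow q (1 / 2))⁻¹) := by
  rw [gammaNum, qPow_neg hq, qPow_neg hq, qPow_half_zpow hq]

theorem alphaNum_one {q : ℝ} (hq : 0 < q) :
    alphaNum q 1 = (qPow q (1 / 2) + (qPow q (1 / 2))⁻¹) / 2 := by
  rw [alphaNum_eq hq, zpow_one]

theorem qPow_half_pow_ne_one {q : ℝ} (hq0 : 0 < q) (hq1 : q < 1) {n : ℕ} (hn : n ≠ 0) :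
    qPow q (1 / 2) ^ n ≠ 1 := by
  unfold qPow
  rw [← Complex.ofReal_pow]
  have h : q ^ (1 / 2 : ℝ) < 1 := Real.rpow_lt_one hq0.le hq1 (by norm_num)
  have h' : (q ^ (1 / 2 : ℝ)) ^ n < 1 := pow_lt_one₀ (Real.rpow_pos_of_pos hq0 _).le h hn
  exact_mod_cast h'.ne

theorem qPow_half_sub_inv_ne_zero {q : ℝ} (hq0 : 0 < q) (hq1 : q < 1) :
    qPow q (1 / 2) - (qPow q (1 / 2))⁻¹ ≠ 0 := by
  have h0 := qPow_ne_zero hq0 (1 / 2)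
  have h := qPow_half_pow_ne_one hq0 hq1 two_ne_zero
  intro h'
  apply h
  field_simp at h'
  linear_combination h'

theorem alphaNum_ne_zero {q : ℝ} (hq : 0 < q) (n : ℤ) : alphaNum q n ≠ 0 := by
  have h : 0 < (q ^ ((n : ℝ) / 2) + q ^ (-((n : ℝ) / 2))) / 2 := by positivity
  unfold alphaNum qPow
  exact_mod_cast h.ne'

theorem gammaNum_ne_zero {q : ℝ} (hq0 : 0 < q) (hq1 : q < 1) {n : ℕ} (hn : n ≠ 0) :
    gammaNum q n ≠ 0 := by
  rw [gammaNum_eq hq0]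
  refine div_ne_zero ?_ (qPow_half_sub_inv_ne_zero hq0 hq1)
  have h0 : qPow q (1 / 2) ^ n ≠ 0 := pow_ne_zero _ (qPow_ne_zero hq0 (1 / 2))
  have h := qPow_half_pow_ne_one hq0 hq1 (n := n * 2) (by omega)
  rw [zpow_natCast]
  intro h'
  apply h
  rw [pow_mul]
  field_simp at h'
  linear_combination h'

theorem gammaNum_zero (q : ℝ) : gammaNum q 0 = 0 := by simp [gammaNum]

theorem alphaNum_zero (q : ℝ) : alphaNum q 0 = 1 := by
  simp [alphaNum, qPow]

theorem gammaNum_one {q : ℝ} (hq0 : 0 < q) (hq1 : q < 1) : gammaNum q 1 = 1 := by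
  rw [gammaNum_eq hq0, zpow_one]
  exact div_self (qPow_half_sub_inv_ne_zero hq0 hq1)

/-- This and `alphaNum_succ` are the addition formulas of hyperbolic functions: with `q^{1/2} =
e^τ`, `α_n = cosh nτ` and `γ_n = sinh nτ / sinh τ`. They drive the leading-coefficient induction in
`Sq_Dq_coeff`. -/
theorem gammaNum_succ {q : ℝ} (hq0 : 0 < q) (hq1 : q < 1) (n : ℤ) :
    gammaNum q (n + 1) = alphaNum q n + alphaNum q 1 * gammaNum q n := by
  have h0 := qPow_ne_zero hq0 (1 / 2)
  have h1 := qPow_half_sub_inv_ne_zero hq0 hq1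
  rw [gammaNum_eq hq0, gammaNum_eq hq0, alphaNum_eq hq0, alphaNum_one hq0, zpow_add_one₀ h0]
  have h2 := zpow_ne_zero n h0
  generalize qPow q (1 / 2) ^ n = t at *
  generalize qPow q (1 / 2) = s at *
  rw [div_eq_iff h1, mul_div_assoc', add_mul, div_mul_cancel₀ _ h1]
  field_simp
  ring

theorem alphaNum_succ {q : ℝ} (hq0 : 0 < q) (hq1 : q < 1) (n : ℤ) :
    alphaNum q (n + 1) =
      (alphaNum q 1 ^ 2 - 1) * gammaNum q n + alphaNum q 1 * alphaNum q n := by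
  have h0 := qPow_ne_zero hq0 (1 / 2)
  have h1 := qPow_half_sub_inv_ne_zero hq0 hq1
  rw [alphaNum_one hq0, gammaNum_eq hq0, alphaNum_eq hq0, alphaNum_eq hq0, zpow_add_one₀ h0]
  have h2 := zpow_ne_zero n h0
  generalize qPow q (1 / 2) ^ n = t at *
  generalize qPow q (1 / 2) = s at *
  have h3 : ((s + s⁻¹) / 2) ^ 2 - 1 = (s - s⁻¹) * (s - s⁻¹) / 4 := by
    field_simp
    ring
  rw [h3, div_mul_div_comm, mul_comm (4 : ℂ), mul_assoc, mul_div_mul_left _ _ h1]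
  field_simp
  ring

/-- The identity `cosh² - sinh² = 1`, since `α² - 1 = sinh² τ`. -/
theorem alphaNum_sq_sub {q : ℝ} (hq0 : 0 < q) (hq1 : q < 1) (n : ℤ) :
    alphaNum q n ^ 2 - (alphaNum q 1 ^ 2 - 1) * gammaNum q n ^ 2 = 1 := by
  have h0 := qPow_ne_zero hq0 (1 / 2)
  have h1 := qPow_half_sub_inv_ne_zero hq0 hq1
  rw [alphaNum_one hq0, gammaNum_eq hq0, alphaNum_eq hq0]
  have h2 := zpow_ne_zero n h0
  generalize qPow q (1 / 2) ^ n = t at *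
  generalize qPow q (1 / 2) = s at *
  have h3 : ((s + s⁻¹) / 2) ^ 2 - 1 = (s - s⁻¹) ^ 2 / 4 := by
    field_simp
    ring
  rw [h3, div_pow (t - t⁻¹), div_mul_div_comm, mul_comm (4 : ℂ), mul_div_mul_left _ _ (pow_ne_zero 2 h1)]
  field_simp
  ring

/-! ### Product rules and commutation relations for `𝒟` and `𝒮`. -/

section Operators

variable {q : ℝ} (hq0 : 0 < q) (hq1 : q < 1)
include hq0

theorem Sq_eq {f g : ℂ[X]} (h : IsAverage q f g) : Sq q f = g :=
  (isAverage_Sq hq0 f).unique h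

theorem Sq_add (f g : ℂ[X]) : Sq q (f + g) = Sq q f + Sq q g := by
  refine Sq_eq hq0 fun w hw => ?_
  have e₁ := isAverage_Sq hq0 f w hw
  have e₂ := isAverage_Sq hq0 g w hw
  simp only [breve, eval_add] at *
  linear_combination e₁ + e₂

theorem Sq_C (a : ℂ) : Sq q (C a) = C a :=
  Sq_eq hq0 fun w _ => by simp [breve]

theorem Sq_one : Sq q 1 = 1 := by simpa using Sq_C hq0 1

theorem Sq_C_mul (a : ℂ) (f : ℂ[X]) : Sq q (C a * f) = C a * Sq q f := by
  refine Sq_eq hq0 fun w hw => ?_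
  have e₁ := isAverage_Sq hq0 f w hw
  simp only [breve, eval_mul, eval_C] at *
  linear_combination a * e₁

theorem Sq_X : Sq q X = C (alphaNum q 1) * X := by
  refine Sq_eq hq0 fun w hw => ?_
  have h0 := qPow_ne_zero hq0 (1 / 2)
  rw [alphaNum_one hq0, qPow_neg hq0]
  generalize qPow q (1 / 2) = s at *
  simp only [breve, eval_mul, eval_C, eval_X]
  field_simp
  ring

include hq1

theorem Dq_eq {f g : ℂ[X]} (h : IsDivDiff q f g) : Dq q f = g :=
  (isDivDiff_Dq hq0 f).unique hq0 hq1 h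

theorem Dq_add (f g : ℂ[X]) : Dq q (f + g) = Dq q f + Dq q g := by
  refine Dq_eq hq0 hq1 fun w hw => ?_
  have e₁ := isDivDiff_Dq hq0 f w hw
  have e₂ := isDivDiff_Dq hq0 g w hw
  simp only [breve, eval_add] at *
  linear_combination e₁ + e₂

theorem Dq_C (a : ℂ) : Dq q (C a) = 0 :=
  Dq_eq hq0 hq1 fun w _ => by simp [breve]

theorem Dq_one : Dq q 1 = 0 := by simpa using Dq_C hq0 hq1 1

theorem Dq_C_mul (a : ℂ) (f : ℂ[X]) : Dq q (C a * f) = C a * Dq q f := by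
  refine Dq_eq hq0 hq1 fun w hw => ?_
  have e₁ := isDivDiff_Dq hq0 f w hw
  simp only [breve, eval_mul, eval_C] at *
  linear_combination a * e₁

theorem Dq_X : Dq q X = 1 :=
  Dq_eq hq0 hq1 fun w _ => by simp [breve]

/-- The product rule for the Askey-Wilson operator. -/
theorem Dq_mul (f g : ℂ[X]) : Dq q (f * g) = Dq q f * Sq q g + Sq q f * Dq q g := by
  refine Dq_eq hq0 hq1 fun w hw => ?_
  have e₁ := isDivDiff_Dq hq0 f w hw
  have e₂ := isDivDiff_Dq hq0 g w hw
  have e₃ := isAverage_Sq hq0 f w hw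
  have e₄ := isAverage_Sq hq0 g w hw
  have hm : ∀ (f g : ℂ[X]) (w : ℂ), breve (f * g) w = breve f w * breve g w := by
    simp [breve]
  have ha : ∀ (f g : ℂ[X]) (w : ℂ), breve (f + g) w = breve f w + breve g w := by
    simp [breve]
  rw [ha, hm, hm, hm, hm, e₃, e₄]
  linear_combination (breve g (qPow q (1 / 2) * w) + breve g (qPow q (-(1 / 2)) * w)) / 2 * e₁ +
    (breve f (qPow q (1 / 2) * w) + breve f (qPow q (-(1 / 2)) * w)) / 2 * e₂

omit hq1 in
/-- The product rule for the averaging operator. -/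
theorem Sq_mul (f g : ℂ[X]) :
    Sq q (f * g) =
      C (alphaNum q 1 ^ 2 - 1) * (X ^ 2 - 1) * (Dq q f * Dq q g) + Sq q f * Sq q g := by
  refine Sq_eq hq0 fun w hw => ?_
  have e₁ := isDivDiff_Dq hq0 f w hw
  have e₂ := isDivDiff_Dq hq0 g w hw
  have e₃ := isAverage_Sq hq0 f w hw
  have e₄ := isAverage_Sq hq0 g w hw
  have hm : ∀ (f g : ℂ[X]) (w : ℂ), breve (f * g) w = breve f w * breve g w := by
    simp [breve]
  have ha : ∀ (f g : ℂ[X]) (w : ℂ), breve (f + g) w = breve f w + breve g w := by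
    simp [breve]
  have hU : breve (C (alphaNum q 1 ^ 2 - 1) * (X ^ 2 - 1)) w =
      (breve X (qPow q (1 / 2) * w) - breve X (qPow q (-(1 / 2)) * w)) ^ 2 / 4 := by
    have h0 := qPow_ne_zero hq0 (1 / 2)
    rw [alphaNum_one hq0, qPow_neg hq0]
    generalize qPow q (1 / 2) = s at *
    simp only [breve, eval_mul, eval_C, eval_X, eval_sub, eval_pow, eval_one]
    field_simp
    ring
  rw [ha, hm _ (Dq q f * Dq q g), hU, hm, hm, hm, hm, e₃, e₄]
  have h : (breve f (qPow q (1 / 2) * w) - breve f (qPow q (-(1 / 2)) * w)) *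
      (breve g (qPow q (1 / 2) * w) - breve g (qPow q (-(1 / 2)) * w)) =
      breve (Dq q f) w * (breve X (qPow q (1 / 2) * w) - breve X (qPow q (-(1 / 2)) * w)) *
      (breve (Dq q g) w * (breve X (qPow q (1 / 2) * w) - breve X (qPow q (-(1 / 2)) * w))) := by
    rw [e₁, e₂]
  linear_combination (-1 / 4) * h

theorem Dq_X_mul (f : ℂ[X]) : Dq q (X * f) = Sq q f + C (alphaNum q 1) * X * Dq q f := by
  rw [Dq_mul hq0 hq1, Dq_X hq0 hq1, Sq_X hq0, one_mul]

theorem Sq_X_mul (f : ℂ[X]) :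
    Sq q (X * f) =
      C (alphaNum q 1 ^ 2 - 1) * (X ^ 2 - 1) * Dq q f + C (alphaNum q 1) * X * Sq q f := by
  rw [Sq_mul hq0, Dq_X hq0 hq1, Sq_X hq0, one_mul]

theorem Dq_quad (a b c : ℂ) :
    Dq q (C a * X ^ 2 + C b * X + C c) = C (2 * alphaNum q 1 * a) * X + C b := by
  rw [Dq_add hq0 hq1, Dq_add hq0 hq1, Dq_C_mul hq0 hq1, Dq_C_mul hq0 hq1, pow_two,
    Dq_X_mul hq0 hq1, Sq_X hq0, Dq_X hq0 hq1, Dq_C hq0 hq1]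
  simp only [map_mul, map_ofNat]
  ring

theorem Sq_quad (a b c : ℂ) :
    Sq q (C a * X ^ 2 + C b * X + C c) =
      C a * (C (alphaNum q 1 ^ 2 - 1) * (X ^ 2 - 1) + C (alphaNum q 1 ^ 2) * X ^ 2) +
        C (alphaNum q 1 * b) * X + C c := by
  rw [Sq_add hq0, Sq_add hq0, Sq_C_mul hq0, Sq_C_mul hq0, pow_two,
    Sq_X_mul hq0 hq1, Sq_X hq0, Dq_X hq0 hq1, Sq_C hq0]
  simp only [map_mul, map_pow]
  ring

/-- The two relations are proved together, because passing from `f` to `X * f` mixes them: each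
identity for `X * f` is a combination of both identities for `f`. -/
theorem Dq_Sq_and_Sq_Sq (f : ℂ[X]) :
    Dq q (Sq q f) = C (alphaNum q 1) * Sq q (Dq q f) +
        C (alphaNum q 1 ^ 2 - 1) * X * Dq q (Dq q f) ∧
      Sq q (Sq q f) = C (alphaNum q 1) * (C (alphaNum q 1 ^ 2 - 1) * (X ^ 2 - 1)) * Dq q (Dq q f) +
        C (alphaNum q 1 ^ 2 - 1) * X * Sq q (Dq q f) + f := by
  have hstep : ∀ f : ℂ[X], _ → _ := fun f (h :
    Dq q (Sq q f) = C (alphaNum q 1) * Sq q (Dq q f) +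
        C (alphaNum q 1 ^ 2 - 1) * X * Dq q (Dq q f) ∧
      Sq q (Sq q f) = C (alphaNum q 1) * (C (alphaNum q 1 ^ 2 - 1) * (X ^ 2 - 1)) * Dq q (Dq q f) +
        C (alphaNum q 1 ^ 2 - 1) * X * Sq q (Dq q f) + f) =>
    show Dq q (Sq q (X * f)) = C (alphaNum q 1) * Sq q (Dq q (X * f)) +
        C (alphaNum q 1 ^ 2 - 1) * X * Dq q (Dq q (X * f)) ∧
      Sq q (Sq q (X * f)) =
        C (alphaNum q 1) * (C (alphaNum q 1 ^ 2 - 1) * (X ^ 2 - 1)) * Dq q (Dq q (X * f)) +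
        C (alphaNum q 1 ^ 2 - 1) * X * Sq q (Dq q (X * f)) + X * f by
      obtain ⟨h₁, h₂⟩ := h
      -- Written as a full quadratic so that `Dq_quad` and `Sq_quad` apply to it.
      have hU : C (alphaNum q 1 ^ 2 - 1) * (X ^ 2 - 1) * Dq q f =
          (C (alphaNum q 1 ^ 2 - 1) * X ^ 2 + C 0 * X + C (-(alphaNum q 1 ^ 2 - 1))) * Dq q f := by
        simp only [map_neg, map_zero]
        ring
      rw [Sq_X_mul hq0 hq1, Dq_X_mul hq0 hq1, hU]
      simp only [Dq_add hq0 hq1, Sq_add hq0, mul_assoc, Dq_C_mul hq0 hq1, Sq_C_mul hq0,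
        Dq_X_mul hq0 hq1, Sq_X_mul hq0 hq1]
      rw [Dq_mul hq0 hq1 _ (Dq q f), Sq_mul hq0 _ (Dq q f)]
      simp only [Dq_quad hq0 hq1, Sq_quad hq0 hq1, h₁, h₂]
      simp only [map_mul, map_pow, map_sub, map_one, map_neg, map_zero, map_ofNat]
      constructor <;> ring
  induction f using Polynomial.induction_on' with
  | add p r hp hr =>
    simp only [Dq_add hq0 hq1, Sq_add hq0]
    constructor
    · linear_combination hp.1 + hr.1
    · linear_combination hp.2 + hr.2
  | monomial n a =>
    have key : ∀ n : ℕ, _ := fun n => hstep (X ^ n)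
    have hpow : ∀ n : ℕ, Dq q (Sq q (X ^ n)) = C (alphaNum q 1) * Sq q (Dq q (X ^ n)) +
        C (alphaNum q 1 ^ 2 - 1) * X * Dq q (Dq q (X ^ n)) ∧
      Sq q (Sq q (X ^ n)) =
        C (alphaNum q 1) * (C (alphaNum q 1 ^ 2 - 1) * (X ^ 2 - 1)) * Dq q (Dq q (X ^ n)) +
        C (alphaNum q 1 ^ 2 - 1) * X * Sq q (Dq q (X ^ n)) + X ^ n := by
      intro n
      induction n with
      | zero =>
        have hS0 : Sq q 0 = 0 := by simpa using Sq_C hq0 0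
        have hD0 : Dq q 0 = 0 := by simpa using Dq_C hq0 hq1 0
        simp [Sq_one hq0, Dq_one hq0 hq1, hS0, hD0]
      | succ n ih =>
        rw [pow_succ']
        exact key n ih
    rw [← C_mul_X_pow_eq_monomial]
    simp only [Dq_C_mul hq0 hq1, Sq_C_mul hq0]
    obtain ⟨h₁, h₂⟩ := hpow n
    constructor
    · rw [h₁]
      ring
    · rw [h₂]
      ring

end Operators

/-! ### Degrees and leading coefficients; inverting `𝒟` and `𝒮`. -/

section Degree

variable {q : ℝ} (hq0 : 0 < q) (hq1 : q < 1)
include hq0 hq1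

/-- Induction through `f = X * f.divX + const`, where the product rules reproduce the recurrences of
`α_n` and `γ_n`. Using `X * Dq q f` in place of `Dq q f` keeps the index equal to `n`, so that
constants need no exception. -/
theorem Sq_Dq_coeff (n : ℕ) : ∀ f : ℂ[X], f.natDegree ≤ n →
    (∀ i, n < i → (Sq q f).coeff i = 0) ∧ (Sq q f).coeff n = alphaNum q n * f.coeff n ∧
      (∀ i, n < i → (X * Dq q f).coeff i = 0) ∧
        (X * Dq q f).coeff n = gammaNum q n * f.coeff n := by
  induction n with
  | zero =>
    intro f hf
    rw [eq_C_of_natDegree_le_zero hf, Sq_C hq0, Dq_C hq0 hq1]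
    refine ⟨fun i hi => ?_, ?_, ?_, ?_⟩
    · rw [coeff_C, if_neg (by omega)]
    · simp [alphaNum_zero]
    · simp
    · simp [gammaNum_zero]
  | succ n ih =>
    intro f hf
    obtain ⟨h₁, h₂, h₃, h₄⟩ := ih f.divX (by rw [natDegree_divX_eq_natDegree_tsub_one]; omega)
    have hf' : f = X * f.divX + C (f.coeff 0) := by rw [mul_comm, divX_mul_X_add]
    have hc : f.divX.coeff n = f.coeff (n + 1) := by simp
    rw [hc] at h₂ h₄
    have hS : Sq q f = C (alphaNum q 1 ^ 2 - 1) * (X * (X * Dq q f.divX) - Dq q f.divX) +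
        C (alphaNum q 1) * (X * Sq q f.divX) + C (f.coeff 0) := by
      conv_lhs => rw [hf']
      rw [Sq_add hq0, Sq_X_mul hq0 hq1, Sq_C hq0]
      ring
    have hD : X * Dq q f = X * Sq q f.divX + C (alphaNum q 1) * (X * (X * Dq q f.divX)) := by
      conv_lhs => rw [hf']
      rw [Dq_add hq0 hq1, Dq_X_mul hq0 hq1, Dq_C hq0 hq1]
      ring
    have hD' : ∀ i, n ≤ i → (Dq q f.divX).coeff i = 0 := fun i hi => by
      rw [← coeff_X_mul, h₃ _ (by omega)]
    rw [hS, hD]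
    refine ⟨fun i hi => ?_, ?_, fun i hi => ?_, ?_⟩
    · obtain ⟨j, rfl⟩ : ∃ j, i = j + 1 := ⟨i - 1, by omega⟩
      simp only [coeff_add, coeff_sub, coeff_C_mul, coeff_X_mul, coeff_C_succ]
      rw [h₁ j (by omega), h₃ j (by omega), hD' _ (by omega)]
      ring
    · simp only [coeff_add, coeff_sub, coeff_C_mul, coeff_X_mul, coeff_C_succ]
      rw [h₂, h₄, hD' _ (by omega)]
      push_cast
      rw [alphaNum_succ hq0 hq1]
      ring
    · obtain ⟨j, rfl⟩ : ∃ j, i = j + 1 := ⟨i - 1, by omega⟩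
      simp only [coeff_add, coeff_C_mul, coeff_X_mul]
      rw [h₁ j (by omega), h₃ j (by omega)]
      ring
    · simp only [coeff_add, coeff_C_mul, coeff_X_mul]
      rw [h₂, h₄]
      push_cast
      rw [gammaNum_succ hq0 hq1]
      ring

theorem coeff_Sq {f : ℂ[X]} {n : ℕ} (hf : f.natDegree ≤ n) :
    (Sq q f).coeff n = alphaNum q n * f.coeff n :=
  (Sq_Dq_coeff hq0 hq1 n f hf).2.1

theorem coeff_Dq_eq_zero {f : ℂ[X]} {n i : ℕ} (hf : f.natDegree ≤ n) (hi : n ≤ i) :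
    (Dq q f).coeff i = 0 := by
  rw [← coeff_X_mul, (Sq_Dq_coeff hq0 hq1 n f hf).2.2.1 _ (by omega)]

theorem natDegree_Dq_le {f : ℂ[X]} {n : ℕ} (hf : f.natDegree ≤ n + 1) :
    (Dq q f).natDegree ≤ n :=
  natDegree_le_iff_coeff_eq_zero.2 fun _ hi => coeff_Dq_eq_zero hq0 hq1 hf hi

theorem coeff_Dq {f : ℂ[X]} {n : ℕ} (hf : f.natDegree ≤ n + 1) :
    (Dq q f).coeff n = gammaNum q (n + 1) * f.coeff (n + 1) := by
  rw [← coeff_X_mul, (Sq_Dq_coeff hq0 hq1 (n + 1) f hf).2.2.2]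
  push_cast
  rfl

theorem Sq_eq_zero {f : ℂ[X]} (hf : Sq q f = 0) : f = 0 := by
  have h := coeff_Sq hq0 hq1 (le_refl f.natDegree)
  rw [hf, coeff_zero, eq_comm, mul_eq_zero] at h
  exact leadingCoeff_eq_zero.1 (h.resolve_left (alphaNum_ne_zero hq0 _))

/-- Since `γ_{n+1} ≠ 0`, the top coefficient can be removed with a multiple of `𝒟 X^{n+1}`. -/
theorem Dq_surjective (n : ℕ) : ∀ h : ℂ[X], (∀ i, n ≤ i → h.coeff i = 0) → ∃ g, Dq q g = h := by
  induction n with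
  | zero =>
    intro h hh
    refine ⟨0, ?_⟩
    have : h = 0 := by
      ext i
      simpa using hh i (Nat.zero_le i)
    rw [this]
    simpa using Dq_C hq0 hq1 0
  | succ n ih =>
    intro h hh
    have hγ : gammaNum q ((n : ℤ) + 1) ≠ 0 := by
      have := gammaNum_ne_zero hq0 hq1 (Nat.succ_ne_zero n)
      push_cast at this
      exact this
    have hX : (X ^ (n + 1) : ℂ[X]).natDegree ≤ n + 1 := natDegree_X_pow_le _
    obtain ⟨g, hg⟩ := ih (h - C (h.coeff n / gammaNum q ((n : ℤ) + 1)) * Dq q (X ^ (n + 1)))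
      fun i hi => by
        rcases hi.eq_or_lt with rfl | hi
        · rw [coeff_sub, coeff_C_mul, coeff_Dq hq0 hq1 hX, coeff_X_pow_self]
          field_simp
          ring
        · rw [coeff_sub, coeff_C_mul, coeff_Dq_eq_zero hq0 hq1 hX hi, hh i hi]
          ring
    refine ⟨g + C (h.coeff n / gammaNum q ((n : ℤ) + 1)) * X ^ (n + 1), ?_⟩
    rw [Dq_add hq0 hq1, Dq_C_mul hq0 hq1, hg]
    ring

/-- A left inverse of the injective map `𝒮` transports `ℓ`. This supplies the auxiliary functional
in `pearson_of_structure`. -/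
theorem exists_functional_Sq (ℓ : ℂ[X] →ₗ[ℂ] ℂ) :
    ∃ v : ℂ[X] →ₗ[ℂ] ℂ, ∀ f, v (Sq q f) = ℓ f := by
  let S : ℂ[X] →ₗ[ℂ] ℂ[X] :=
    { toFun := Sq q
      map_add' := Sq_add hq0
      map_smul' := fun a f => by
        simp only [smul_eq_C_mul, Sq_C_mul hq0, RingHom.id_apply] }
  obtain ⟨T, hT⟩ := S.exists_leftInverse_of_injective
    (LinearMap.ker_eq_bot'.2 fun f hf => Sq_eq_zero hq0 hq1 hf)
  exact ⟨ℓ ∘ₗ T, fun f => congrArg ℓ (LinearMap.congr_fun hT f)⟩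

end Degree

/-! ### The Pearson equation and the second-order equation it implies. -/

section Pearson

/-- The operator `f ↦ φ 𝒟f + ψ 𝒮f` with `φ = 𝔞 z² + 𝔟 z + 𝔠` and `ψ = z - β`. A functional
vanishing on its range satisfies a Pearson-type equation. -/
noncomputable def pearsonOp (q : ℝ) (𝔞 𝔟 𝔠 β : ℂ) (f : ℂ[X]) : ℂ[X] :=
  (C 𝔞 * X ^ 2 + C 𝔟 * X + C 𝔠) * Dq q f + (X - C β) * Sq q f

/-- The eigenvalues of the second-order operator `f ↦ pearsonOp q 𝔞 𝔟 𝔠 β (Dq q f)`. -/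
noncomputable def eigenNum (q : ℝ) (𝔞 : ℂ) (n : ℕ) : ℂ :=
  gammaNum q n * (𝔞 * gammaNum q ((n : ℤ) - 1) + alphaNum q ((n : ℤ) - 1))

variable {q : ℝ} (hq0 : 0 < q) (hq1 : q < 1) (𝔞 𝔟 𝔠 β : ℂ)
include hq0 hq1

theorem pearsonOp_add (f g : ℂ[X]) :
    pearsonOp q 𝔞 𝔟 𝔠 β (f + g) = pearsonOp q 𝔞 𝔟 𝔠 β f + pearsonOp q 𝔞 𝔟 𝔠 β g := by
  simp only [pearsonOp, Dq_add hq0 hq1, Sq_add hq0]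
  ring

theorem pearsonOp_C_mul (a : ℂ) (f : ℂ[X]) :
    pearsonOp q 𝔞 𝔟 𝔠 β (C a * f) = C a * pearsonOp q 𝔞 𝔟 𝔠 β f := by
  simp only [pearsonOp, Dq_C_mul hq0 hq1, Sq_C_mul hq0]
  ring

theorem coeff_pearsonOp {f : ℂ[X]} {n : ℕ} (hf : f.natDegree ≤ n) :
    (∀ i, n + 1 < i → (pearsonOp q 𝔞 𝔟 𝔠 β f).coeff i = 0) ∧
      (pearsonOp q 𝔞 𝔟 𝔠 β f).coeff (n + 1) =
        (𝔞 * gammaNum q n + alphaNum q n) * f.coeff n := by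
  obtain ⟨h₁, h₂, h₃, h₄⟩ := Sq_Dq_coeff hq0 hq1 n f hf
  have hD : ∀ i, n ≤ i → (Dq q f).coeff i = 0 := fun i hi => coeff_Dq_eq_zero hq0 hq1 hf hi
  have e : pearsonOp q 𝔞 𝔟 𝔠 β f = C 𝔞 * (X * (X * Dq q f)) + C 𝔟 * (X * Dq q f) +
      C 𝔠 * Dq q f + X * Sq q f - C β * Sq q f := by
    rw [pearsonOp]
    ring
  rw [e]
  refine ⟨fun i hi => ?_, ?_⟩
  · obtain ⟨j, rfl⟩ : ∃ j, i = j + 1 := ⟨i - 1, by omega⟩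
    rw [coeff_sub, coeff_add, coeff_add, coeff_add, coeff_C_mul, coeff_C_mul, coeff_C_mul,
      coeff_C_mul, coeff_X_mul, coeff_X_mul _ j, coeff_X_mul, h₁ j (by omega),
      h₁ (j + 1) (by omega), h₃ j (by omega), hD _ (by omega), hD _ (by omega)]
    ring
  · rw [coeff_sub, coeff_add, coeff_add, coeff_add, coeff_C_mul, coeff_C_mul, coeff_C_mul,
      coeff_C_mul, coeff_X_mul, coeff_X_mul _ n, coeff_X_mul, h₁ (n + 1) (by omega), h₂, h₄,
      hD _ (by omega), hD _ (by omega)]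
    ring

theorem coeff_pearsonOp_Dq {f : ℂ[X]} {n : ℕ} (hf : f.natDegree ≤ n) :
    (∀ i, n < i → (pearsonOp q 𝔞 𝔟 𝔠 β (Dq q f)).coeff i = 0) ∧
      (pearsonOp q 𝔞 𝔟 𝔠 β (Dq q f)).coeff n = eigenNum q 𝔞 n * f.coeff n := by
  cases n with
  | zero =>
    have hS0 : Sq q 0 = 0 := by simpa using Sq_C hq0 0
    have hD0 : Dq q 0 = 0 := by simpa using Dq_C hq0 hq1 0
    rw [eq_C_of_natDegree_le_zero hf, Dq_C hq0 hq1]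
    simp [pearsonOp, hS0, hD0, eigenNum, gammaNum_zero]
  | succ n =>
    obtain ⟨h₁, h₂⟩ := coeff_pearsonOp hq0 hq1 𝔞 𝔟 𝔠 β (natDegree_Dq_le hq0 hq1 hf)
    refine ⟨h₁, ?_⟩
    rw [h₂, coeff_Dq hq0 hq1 hf, eigenNum]
    push_cast
    rw [add_sub_cancel_right]
    ring

/-- The terms are grouped so that `g` enters only through `𝒮g` and `𝒟g`, which allows `g` to be
chosen freely against a fixed `f`. -/
theorem pearsonOp_mul (f g : ℂ[X]) :
    pearsonOp q 𝔞 𝔟 𝔠 β (f * g) = pearsonOp q 𝔞 𝔟 𝔠 β f * Sq q g +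
      Dq q g * ((C 𝔞 * X ^ 2 + C 𝔟 * X + C 𝔠) * Sq q f +
        (X - C β) * (C (alphaNum q 1 ^ 2 - 1) * (X ^ 2 - 1)) * Dq q f) := by
  simp only [pearsonOp, Dq_mul hq0 hq1, Sq_mul hq0]
  ring

variable {𝔞 𝔟 𝔠 β} {u : ℂ[X] →ₗ[ℂ] ℂ} (hu : ∀ f, u (pearsonOp q 𝔞 𝔟 𝔠 β f) = 0)
include hu

/-- The right side depends only on the product `𝒟f 𝒟g`, hence is symmetric in `f` and `g`; this is
the self-adjointness of the second-order operator. -/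
theorem apply_pearsonOp_Dq_mul (f g : ℂ[X]) :
    alphaNum q 1 * u (pearsonOp q 𝔞 𝔟 𝔠 β (Dq q f) * g) =
      -u ((C 𝔞 * X ^ 2 + C 𝔟 * X + C 𝔠) * Sq q (Dq q f * Dq q g) +
        (X - C β) * (C (alphaNum q 1 ^ 2 - 1) * (X ^ 2 - 1)) * Dq q (Dq q f * Dq q g)) := by
  -- `G` is chosen so that `𝒟G = 𝒮𝒟g`, while `𝒮G` is `α g` plus a multiple of `𝒟²g`. In the Pearson
  -- equation for `𝒟f * G` the remaining terms then recombine, by the product rules, into `𝒮` and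
  -- `𝒟` of `𝒟f 𝒟g`.
  set G := C (alphaNum q 1) * Sq q g + C (-(alphaNum q 1 ^ 2 - 1)) * (X * Dq q g) with hG
  obtain ⟨h₁, h₂⟩ := Dq_Sq_and_Sq_Sq hq0 hq1 g
  have hS : Sq q G = C (alphaNum q 1) * g +
      C (alphaNum q 1 ^ 2 - 1) * (X ^ 2 - 1) * Dq q (Dq q g) := by
    rw [hG, Sq_add hq0, Sq_C_mul hq0, Sq_C_mul hq0, h₂, Sq_X_mul hq0 hq1]
    simp only [map_pow, map_sub, map_one, map_neg]
    ring
  have hD : Dq q G = Sq q (Dq q g) := by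
    rw [hG, Dq_add hq0 hq1, Dq_C_mul hq0 hq1, Dq_C_mul hq0 hq1, h₁, Dq_X_mul hq0 hq1]
    simp only [map_pow, map_sub, map_one, map_neg]
    ring
  have h := hu (Dq q f * G)
  rw [← smul_eq_mul, ← map_smul, eq_neg_iff_add_eq_zero, ← map_add, ← h, smul_eq_C_mul,
    pearsonOp_mul hq0 hq1, hS, hD, Dq_mul hq0 hq1, Sq_mul hq0, pearsonOp]
  congr 1
  ring

theorem apply_pearsonOp_Dq_mul_comm (f g : ℂ[X]) :
    u (pearsonOp q 𝔞 𝔟 𝔠 β (Dq q f) * g) = u (pearsonOp q 𝔞 𝔟 𝔠 β (Dq q g) * f) := by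
  refine mul_left_cancel₀ (alphaNum_ne_zero hq0 1) ?_
  rw [apply_pearsonOp_Dq_mul hq0 hq1 hu, apply_pearsonOp_Dq_mul hq0 hq1 hu,
    mul_comm (Dq q f)]

variable {P : ℕ → ℂ[X]} (hP : IsMonicOPS u P)
include hP

omit hq0 hq1 hu in
theorem IsMonicOPS.coeff_self (n : ℕ) : (P n).coeff n = 1 := by
  have := hP.monic n
  rwa [Monic, leadingCoeff, hP.natDegree_eq] at this

/-- The second-order difference equation satisfied by the orthogonal polynomials of a
functional which satisfies a Pearson-type equation. -/
theorem pearsonOp_Dq_eq (n : ℕ) :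
    pearsonOp q 𝔞 𝔟 𝔠 β (Dq q (P n)) = C (eigenNum q 𝔞 n) * P n := by
  have hdeg : ∀ m, (P m).natDegree ≤ m := fun m => (hP.natDegree_eq m).le
  obtain ⟨h₁, h₂⟩ := coeff_pearsonOp_Dq hq0 hq1 𝔞 𝔟 𝔠 β (hdeg n)
  rw [hP.coeff_self, mul_one] at h₂
  rw [← sub_eq_zero]
  refine hP.eq_zero_of_forall n _ (fun i hi => ?_) fun m hm => ?_
  · rw [coeff_sub, coeff_C_mul]
    rcases hi.eq_or_lt with rfl | hi
    · rw [h₂, hP.coeff_self]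
      ring
    · rw [h₁ i hi, coeff_eq_zero_of_natDegree_lt ((hdeg n).trans_lt hi)]
      ring
  · rw [sub_mul, map_sub, mul_assoc, ← smul_eq_C_mul, map_smul, hP.orthogonal n m (by omega),
      apply_pearsonOp_Dq_mul_comm hq0 hq1 hu,
      hP.apply_mul_eq_zero n n _ le_rfl fun i hi =>
        (coeff_pearsonOp_Dq hq0 hq1 𝔞 𝔟 𝔠 β (hdeg m)).1 i (by omega)]
    simp

/-- Regularity forces the admissibility of the pair `(φ, ψ)`. -/
theorem admissible_of_pearsonOp (n : ℕ) : 𝔞 * gammaNum q n + alphaNum q n ≠ 0 := by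
  intro h0
  have hdeg : (P (n + 1)).natDegree ≤ n + 1 := (hP.natDegree_eq _).le
  have hL := pearsonOp_Dq_eq hq0 hq1 hu hP (n + 1)
  set F := Dq q (P (n + 1)) with hF
  have hFdeg : F.natDegree ≤ n := natDegree_Dq_le hq0 hq1 hdeg
  have hFc : F.coeff n = gammaNum q (n + 1) := by
    rw [hF, coeff_Dq hq0 hq1 hdeg, hP.coeff_self, mul_one]
  have hγ : gammaNum q ((n : ℤ) + 1) ≠ 0 := by
    have := gammaNum_ne_zero hq0 hq1 (Nat.succ_ne_zero n)
    push_cast at this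
    exact this
  have hlam : eigenNum q 𝔞 (n + 1) = 0 := by
    rw [eigenNum]
    push_cast
    rw [add_sub_cancel_right, h0, mul_zero]
  rw [hlam, map_zero, zero_mul] at hL
  -- The image of `F` under the operator is zero here, so the Pearson equation for `F * G` reduces
  -- to `u (𝒟G * Y) = 0`. As `𝒟` is surjective and `u` regular, `Y = 0`.
  set Y := (C 𝔞 * X ^ 2 + C 𝔟 * X + C 𝔠) * Sq q F +
    (X - C β) * (C (alphaNum q 1 ^ 2 - 1) * (X ^ 2 - 1)) * Dq q F with hY
  have hY0 : Y = 0 := by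
    refine hP.eq_zero_of_forall (Y.natDegree + 1) _
      (fun i hi => coeff_eq_zero_of_natDegree_lt hi) fun m _ => ?_
    obtain ⟨G, hG⟩ := Dq_surjective hq0 hq1 (m + 1) (P m)
      fun i hi => coeff_eq_zero_of_natDegree_lt (by rw [hP.natDegree_eq]; omega)
    have h := hu (F * G)
    rw [pearsonOp_mul hq0 hq1, hL, zero_mul, zero_add, hG] at h
    rw [mul_comm]
    exact h
  -- Eliminating `φ` from the two equations leaves `(𝒮F)² = (α² - 1)(z² - 1)(𝒟F)²`. By
  -- `alphaNum_sq_sub` the coefficients of `z^{2n}` differ by `γ_{n+1}² ≠ 0`, a contradiction.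
  have hsq : (X - C β) * (Sq q F ^ 2 -
      C (alphaNum q 1 ^ 2 - 1) * ((X * Dq q F) ^ 2 - Dq q F ^ 2)) = 0 := by
    rw [pearsonOp] at hL
    rw [hY] at hY0
    linear_combination Sq q F * hL - Dq q F * hY0
  have hsq' := (mul_eq_zero.1 hsq).resolve_left (X_sub_C_ne_zero β)
  have hc := congrArg (fun p => p.coeff (2 * n)) hsq'
  obtain ⟨h₁, h₂, h₃, h₄⟩ := Sq_Dq_coeff hq0 hq1 n F hFdeg
  have hD : ∀ i, n ≤ i → (Dq q F).coeff i = 0 := fun i hi => coeff_Dq_eq_zero hq0 hq1 hFdeg hi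
  have d₁ : (Sq q F).natDegree ≤ n := natDegree_le_iff_coeff_eq_zero.2 h₁
  have d₂ : (X * Dq q F).natDegree ≤ n := natDegree_le_iff_coeff_eq_zero.2 h₃
  have d₃ : (Dq q F).natDegree ≤ n := natDegree_le_iff_coeff_eq_zero.2 fun i hi => hD i hi.le
  simp only [coeff_sub, coeff_C_mul, coeff_pow_of_natDegree_le d₁, coeff_pow_of_natDegree_le d₂,
    coeff_pow_of_natDegree_le d₃, h₂, h₄, hD n le_rfl, hFc, coeff_zero] at hc
  have h1 := alphaNum_sq_sub hq0 hq1 n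
  apply hγ
  have : gammaNum q ((n : ℤ) + 1) ^ 2 = 0 := by
    linear_combination hc - gammaNum q ((n : ℤ) + 1) ^ 2 * h1
  exact pow_eq_zero_iff two_ne_zero |>.1 this

end Pearson

/-- The difference factors through the quantities of `admissible_of_pearsonOp`, so admissibility
separates the eigenvalues. -/
theorem eigenNum_sub {q : ℝ} (hq0 : 0 < q) (hq1 : q < 1) (𝔞 : ℂ) (m d : ℕ) :
    eigenNum q 𝔞 (m + d + 1) - eigenNum q 𝔞 m =
      gammaNum q (d + 1) * (𝔞 * gammaNum q ((2 * m + d : ℕ) : ℤ) +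
        alphaNum q ((2 * m + d : ℕ) : ℤ)) := by
  have h0 := qPow_ne_zero hq0 (1 / 2)
  have h1 := qPow_half_sub_inv_ne_zero hq0 hq1
  have e₁ : ((m + d + 1 : ℕ) : ℤ) - 1 = (m : ℤ) + d := by push_cast; ring
  have e₂ : ((2 * m + d : ℕ) : ℤ) = (m : ℤ) + m + d := by push_cast; ring
  rw [eigenNum, eigenNum, e₁, e₂]
  push_cast
  simp only [gammaNum_eq hq0, alphaNum_eq hq0, zpow_sub₀ h0, zpow_add₀ h0, zpow_one]
  have hm : qPow q (1 / 2) ^ (m : ℤ) ≠ 0 := zpow_ne_zero _ h0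
  have hd : qPow q (1 / 2) ^ (d : ℤ) ≠ 0 := zpow_ne_zero _ h0
  generalize qPow q (1 / 2) ^ (m : ℤ) = x at *
  generalize qPow q (1 / 2) ^ (d : ℤ) = y at *
  generalize qPow q (1 / 2) = s at *
  have h2 : s ^ 2 - 1 ≠ 0 := by
    intro h
    apply h1
    field_simp
    rw [h, mul_zero]
  field_simp
  ring

theorem eigenNum_ne {q : ℝ} (hq0 : 0 < q) (hq1 : q < 1) {𝔞 : ℂ}
    (h : ∀ n : ℕ, 𝔞 * gammaNum q n + alphaNum q n ≠ 0) {m n : ℕ} (hmn : m < n) :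
    eigenNum q 𝔞 n - eigenNum q 𝔞 m ≠ 0 := by
  obtain ⟨d, rfl⟩ := Nat.exists_eq_add_of_lt hmn
  rw [eigenNum_sub hq0 hq1]
  have := gammaNum_ne_zero hq0 hq1 (Nat.succ_ne_zero d)
  push_cast at this
  exact mul_ne_zero this (h _)

/-- The Askey-Wilson operator as a linear map. -/
noncomputable def DqLin {q : ℝ} (hq0 : 0 < q) (hq1 : q < 1) : ℂ[X] →ₗ[ℂ] ℂ[X] where
  toFun := Dq q
  map_add' := Dq_add hq0 hq1
  map_smul' a f := by simp only [smul_eq_C_mul, Dq_C_mul hq0 hq1, RingHom.id_apply]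

theorem apply_C_mul (u : ℂ[X] →ₗ[ℂ] ℂ) (a : ℂ) (f : ℂ[X]) : u (C a * f) = a * u f := by
  rw [← smul_eq_C_mul, map_smul, smul_eq_mul]

theorem IsMonicOPS.apply_eq_zero {u : ℂ[X] →ₗ[ℂ] ℂ} {P : ℕ → ℂ[X]} (hP : IsMonicOPS u P)
    {ℓ : ℂ[X] →ₗ[ℂ] ℂ} (h : ∀ n, ℓ (P n) = 0) (f : ℂ[X]) : ℓ f = 0 := by
  suffices H : ∀ (d : ℕ) (f : ℂ[X]), (∀ i, d ≤ i → f.coeff i = 0) → ℓ f = 0 from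
    H (f.natDegree + 1) f fun i hi => coeff_eq_zero_of_natDegree_lt hi
  intro d
  induction d with
  | zero =>
    intro f hf
    have : f = 0 := by
      ext i
      simpa using hf i (Nat.zero_le i)
    rw [this, map_zero]
  | succ d ih =>
    intro f hf
    have h1 := ih (f - C (f.coeff d) * P d) fun i hi => by
      rcases hi.eq_or_lt with rfl | hi
      · rw [coeff_sub, coeff_C_mul, hP.coeff_self]
        ring
      · rw [coeff_sub, coeff_C_mul, hf i hi,
          coeff_eq_zero_of_natDegree_lt ((hP.natDegree_eq d).trans_lt hi)]
        ring
    rwa [map_sub, apply_C_mul, h, mul_zero, sub_zero] at h1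

/-! ### From the structure relation to the Pearson equation. -/

section StructureRelation

variable {q : ℝ} (hq0 : 0 < q) (hq1 : q < 1)
include hq0 hq1

/-- A functional `v` related to `u` by `𝒮v = ρu`, `𝒟v = -ψu` gives a Pearson-type equation
for `u`. -/
theorem apply_pearsonOp_eq_zero {u v : ℂ[X] →ₗ[ℂ] ℂ} {ρ : ℂ[X]} {𝔞 𝔟 𝔠 β : ℂ}
    (hS : ∀ f, v (Sq q f) = u (ρ * f)) (hD : ∀ f, v (Dq q f) = u ((X - C β) * f))
    (hφ : C (alphaNum q 1) * (C 𝔞 * X ^ 2 + C 𝔟 * X + C 𝔠) =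
      -(ρ + C (alphaNum q 1 ^ 2 - 1) * X * (X - C β))) (f : ℂ[X]) :
    u (pearsonOp q 𝔞 𝔟 𝔠 β f) = 0 := by
  have hα := alphaNum_ne_zero hq0 1
  -- `v (X * 𝒟²f)` is the only term here not expressible through `u`; it cancels between `h₁` and
  -- `h₂`.
  have h₁ := congrArg v (Dq_Sq_and_Sq_Sq hq0 hq1 f).1
  have h₂ := congrArg v (Dq_X_mul hq0 hq1 (Dq q f))
  rw [map_add, mul_assoc, apply_C_mul, apply_C_mul, hD, hS] at h₁
  rw [map_add, mul_assoc, apply_C_mul, hD, hS] at h₂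
  have h₃ : C (alphaNum q 1) * pearsonOp q 𝔞 𝔟 𝔠 β f =
      C (alphaNum q 1) * ((X - C β) * Sq q f) - ρ * Dq q f -
        C (alphaNum q 1 ^ 2 - 1) * ((X - C β) * (X * Dq q f)) := by
    rw [pearsonOp]
    linear_combination Dq q f * hφ
  have h₄ := congrArg u h₃
  rw [map_sub, map_sub, apply_C_mul, apply_C_mul, apply_C_mul, h₁] at h₄
  refine (mul_eq_zero.1 (h₄.trans ?_)).resolve_left hα
  linear_combination (alphaNum q 1 ^ 2 - 1) * (-h₂)

variable {u : ℂ[X] →ₗ[ℂ] ℂ} {P : ℕ → ℂ[X]} (hP : IsMonicOPS u P)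
  {a b c : ℂ} {an bn cn : ℕ → ℂ}
  (hrel : ∀ n, (C a * X ^ 2 + C b * X + C c) * Dq q (P n) =
    C (an n) * Sq q (P (n + 1)) + C (bn n) * Sq q (P n) + C (cn n) * Sq q (prev P n))
include hP

omit hq0 hq1 in
theorem IsMonicOPS.zero_eq_one : P 0 = 1 :=
  (hP.monic 0).natDegree_eq_zero.1 (hP.natDegree_eq 0)

omit hq0 hq1 in
theorem IsMonicOPS.one_eq : P 1 = X - C (recB u P 0) := by
  have h := (hP.recurrence 0).1
  rw [hP.zero_eq_one] at h
  simpa [prev] using h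

omit hq0 hq1 in
theorem IsMonicOPS.norm_succ (n : ℕ) :
    u (P (n + 1) * P (n + 1)) = recC u P (n + 1) * u (P n * P n) :=
  (div_mul_cancel₀ _ (hP.regular n)).symm

include hrel

/-- The coefficients of the structure relation for `n = 0, 1`. -/
theorem structure_coeff :
    an 0 = 0 ∧ bn 0 = 0 ∧ an 1 * (2 * alphaNum q 1 ^ 2 - 1) = a ∧
      alphaNum q 1 * (bn 1 - an 1 * (recB u P 0 + recB u P 1)) = b ∧
      an 1 * (1 - alphaNum q 1 ^ 2 + recB u P 0 * recB u P 1 - recC u P 1) -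
        bn 1 * recB u P 0 + cn 1 = c := by
  have hα := alphaNum_ne_zero hq0 1
  have h0 := hrel 0
  have h1 := hrel 1
  have hP2 := (hP.recurrence 1).1
  have hS0 : Sq q 0 = 0 := by simpa using Sq_C hq0 0
  have hp : ∀ β : ℂ, (X : ℂ[X]) - C β = C 0 * X ^ 2 + C 1 * X + C (-β) := fun β => by simp; ring
  have hP2' : P 2 = C 1 * X ^ 2 + C (-(recB u P 0 + recB u P 1)) * X +
      C (recB u P 0 * recB u P 1 - recC u P 1) := by
    rw [hP2, hP.one_eq]
    simp only [prev, hP.zero_eq_one, map_neg, map_add, map_sub, map_mul, map_one]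
    ring
  simp only [prev, zero_add, hP.zero_eq_one, hP.one_eq, hP2', hp, Sq_quad hq0 hq1,
    Dq_quad hq0 hq1, Sq_one hq0, Dq_one hq0 hq1, hS0, Nat.reduceAdd] at h0 h1
  -- All the polynomials involved have degree at most 2, so values at `0, 1, -1` recover their
  -- coefficients.
  have e00 := congrArg (fun p => eval 0 p) h0
  have e01 := congrArg (fun p => eval 1 p) h0
  have e10 := congrArg (fun p => eval 0 p) h1
  have e11 := congrArg (fun p => eval 1 p) h1
  have e12 := congrArg (fun p => eval (-1) p) h1
  simp only [eval_add, eval_mul, eval_sub, eval_C, eval_X, eval_pow, eval_zero, eval_one]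
    at e00 e01 e10 e11 e12
  have ha0 : an 0 = 0 := by
    have : an 0 * alphaNum q 1 = 0 := by linear_combination e00 - e01
    exact (mul_eq_zero.1 this).resolve_right hα
  rw [ha0] at e00
  refine ⟨ha0, ?_, ?_, ?_, ?_⟩
  · linear_combination -e00
  · linear_combination e10 - (e11 + e12) / 2
  · linear_combination (e12 - e11) / 2
  · linear_combination -e10

/-- The structure relation and the two compatibility conditions give a Pearson-type equation
for the orthogonality functional. -/
theorem pearson_of_structure (hcn : ∀ n, cn n ≠ 0) {x y : ℂ}
    (hy : y = (recB u P 1 - recB u P 0) / 2)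
    (hx : x * (cn 3 + 2 * a * recC u P 3) = a * recC u P 3)
    (h2 : x * recC u P 2 * (bn 2 + 2 * a * recB u P 2 + b / alphaNum q 1) +
      y * (cn 2 + 2 * a * recC u P 2) =
        (a * (recB u P 2 + recB u P 1) + b / alphaNum q 1) * recC u P 2)
    (h1 : an 1 * x * recC u P 2 + bn 1 * y + cn 1 =
      a * (recC u P 2 + recB u P 1 ^ 2 + recC u P 1) + b / alphaNum q 1 * recB u P 1 + c +
        a * (1 - alphaNum q 1 ^ 2) - 2 * a * recC u P 1 - 2 * a * y * recB u P 1 -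
        2 * a * x * recC u P 2 - b / alphaNum q 1 * y)
    {𝔞 𝔟 𝔠 : ℂ}
    (hφ : C (alphaNum q 1) * (C 𝔞 * X ^ 2 + C 𝔟 * X + C 𝔠) =
      -(C (recC u P 1) * P 0 + C y * P 1 + C x * P 2 +
        C (alphaNum q 1 ^ 2 - 1) * X * (X - C (recB u P 0)))) (f : ℂ[X]) :
    u (pearsonOp q 𝔞 𝔟 𝔠 (recB u P 0) f) = 0 := by
  have hα := alphaNum_ne_zero hq0 1
  obtain ⟨ha0, hb0, hab⟩ := structure_coeff hq0 hq1 hP hrel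
  set α := alphaNum q 1 with hαdef
  set ρ := C (recC u P 1) * P 0 + C y * P 1 + C x * P 2 with hρ
  obtain ⟨v, hv⟩ := exists_functional_Sq hq0 hq1 (u ∘ₗ LinearMap.mulLeft ℂ ρ)
  replace hv : ∀ f, v (Sq q f) = u (ρ * f) := hv
  refine apply_pearsonOp_eq_zero hq0 hq1 hv ?_ hφ f
  -- `π'` and `m` are determined by `𝒟(π' f) = (a z² + b z + c) 𝒟f + 𝒮(m f)` (`hprod`), which brings
  -- the left side of the structure relation under `𝒟`.
  set π' := C a * X ^ 2 + C (b / α) * X + C (c + a * (1 - α ^ 2)) with hπ'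
  set m := C (2 * a) * X + C (b / α) with hm
  have orth := hP.orthogonal
  have hρP : ∀ j, u (ρ * P j) =
      recC u P 1 * u (P 0 * P j) + y * u (P 1 * P j) + x * u (P 2 * P j) := fun j => by
    rw [hρ, add_mul, add_mul, map_add, map_add, mul_assoc, mul_assoc, mul_assoc, apply_C_mul,
      apply_C_mul, apply_C_mul]
  have hρ0 : u (ρ * P 0) = recC u P 1 * u (P 0 * P 0) := by
    rw [hρP, orth 1 0 (by omega), orth 2 0 (by omega)]
    ring
  have hρ1 : u (ρ * P 1) = y * u (P 1 * P 1) := by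
    rw [hρP, orth 0 1 (by omega), orth 2 1 (by omega)]
    ring
  have hρ2 : u (ρ * P 2) = x * u (P 2 * P 2) := by
    rw [hρP, orth 0 2 (by omega), orth 1 2 (by omega)]
    ring
  have hρ3 : ∀ j, u (ρ * P (j + 3)) = 0 := fun j => by
    rw [hρP, orth 0 _ (by omega), orth 1 _ (by omega), orth 2 _ (by omega)]
    ring
  have n1 := hP.norm_succ 0
  have n2 := hP.norm_succ 1
  have n3 := hP.norm_succ 2
  simp only [Nat.reduceAdd, zero_add] at n1 n2 n3
  set g₁ := an 1 * x * recC u P 2 + bn 1 * y + cn 1 with hg₁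
  set g₂ := a * (recB u P 2 + recB u P 1) + b / α - 2 * a * y - 2 * a * x * recB u P 2 -
    b / α * x with hg₂
  -- The value `y = (B 1 - B 0) / 2` is what removes the component along `P 0`.
  have hG : P 1 * π' - ρ * m = C (a - 2 * a * x) * P 3 + C g₂ * P 2 + C g₁ * P 1 := by
    have e1 : P 1 = X - C (recB u P 0) := hP.one_eq
    have e2 := (hP.recurrence 1).1
    have e3 := (hP.recurrence 2).1
    simp only [Nat.reduceAdd, prev, hP.zero_eq_one] at e2 e3
    have hX : X = P 1 + C (recB u P 0) := by rw [e1]; ring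
    have hy' : C (recB u P 1) = 2 * C y + C (recB u P 0) := by
      rw [hy, ← C_ofNat, ← C_mul, ← C_add]
      congr 1
      simp only [OfNat.ofNat]
      ring
    rw [h1, hg₂, hρ, hπ', hm, e3, e2, hP.zero_eq_one, e1]
    simp only [map_add, map_sub, map_mul, map_one, map_pow, map_ofNat, hy']
    ring
  have hGP : ∀ j, u (P 1 * (π' * P j)) - u (ρ * (m * P j)) =
      (a - 2 * a * x) * u (P 3 * P j) + g₂ * u (P 2 * P j) + g₁ * u (P 1 * P j) := fun j => by
    have : P 1 * (π' * P j) - ρ * (m * P j) = C (a - 2 * a * x) * (P 3 * P j) +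
        C g₂ * (P 2 * P j) + C g₁ * (P 1 * P j) := by linear_combination P j * hG
    rw [← map_sub, this, map_add, map_add, apply_C_mul, apply_C_mul, apply_C_mul]
  have hvrel : ∀ n, v ((C a * X ^ 2 + C b * X + C c) * Dq q (P n)) =
      an n * u (ρ * P (n + 1)) + bn n * u (ρ * P n) + cn n * u (ρ * prev P n) := fun n => by
    rw [hrel, map_add, map_add, apply_C_mul, apply_C_mul, apply_C_mul, hv, hv, hv]
  -- By orthogonality both sides vanish for `n = 0` and `n ≥ 4`; the cases `n = 1, 2, 3` are the
  -- hypotheses `h1`, `h2`, `hx`.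
  have hmain : ∀ n, v ((C a * X ^ 2 + C b * X + C c) * Dq q (P n)) =
      u (P 1 * (π' * P n)) - u (ρ * (m * P n)) := fun n => by
    rw [hvrel, hGP]
    match n with
    | 0 =>
      rw [ha0, hb0, orth 3 0 (by omega), orth 2 0 (by omega), orth 1 0 (by omega)]
      simp [prev]
    | 1 =>
      simp only [Nat.reduceAdd, prev]
      rw [hρ0, hρ1, hρ2, orth 3 1 (by omega), orth 2 1 (by omega), n2, n1, hg₁]
      ring
    | 2 =>
      simp only [Nat.reduceAdd, prev]
      rw [hρ1, hρ2, hρ3 0, orth 3 2 (by omega), orth 1 2 (by omega), n2, hg₂]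
      linear_combination u (P 1 * P 1) * h2
    | 3 =>
      simp only [Nat.reduceAdd, prev]
      rw [hρ2, hρ3 0, hρ3 1, orth 2 3 (by omega), orth 1 3 (by omega), n3]
      linear_combination u (P 2 * P 2) * hx
    | k + 4 =>
      simp only [prev]
      rw [hρ3 (k + 2), hρ3 (k + 1), hρ3 k, orth 3 _ (by omega), orth 2 _ (by omega),
        orth 1 _ (by omega)]
      ring
  have hprod : ∀ f, Dq q (π' * f) =
      (C a * X ^ 2 + C b * X + C c) * Dq q f + Sq q (m * f) := fun f => by
    have hmq : m = C 0 * X ^ 2 + C (2 * a) * X + C (b / α) := by simp [hm]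
    have hb : C b = C α * C (b / α) := by
      rw [← C_mul]
      congr 1
      field_simp
    rw [Dq_mul hq0 hq1, Sq_mul hq0, hmq, hπ', Dq_quad hq0 hq1, Sq_quad hq0 hq1,
      Dq_quad hq0 hq1, Sq_quad hq0 hq1, hb, ← hαdef]
    simp only [map_add, map_sub, map_mul, map_one, map_pow, map_zero, map_ofNat]
    ring
  -- `δ` is the defect in `v (𝒟f) = u (P 1 * f)`. It kills all multiples of `π'`, and also `1` and
  -- `X`; the coefficient `C_1` of `P 0` in `ρ` is what makes `δ X = 0`. Division by `π'`, of degree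
  -- at most 2, then gives `δ = 0`.
  let δ : ℂ[X] →ₗ[ℂ] ℂ := v ∘ₗ DqLin hq0 hq1 - u ∘ₗ LinearMap.mulLeft ℂ (P 1)
  have hδ : ∀ f, δ f = v (Dq q f) - u (P 1 * f) := fun f => rfl
  have hδπ : ∀ f, δ (π' * f) = 0 := by
    have h := hP.apply_eq_zero (ℓ := δ ∘ₗ LinearMap.mulLeft ℂ π') fun n => by
      change δ (π' * P n) = 0
      rw [hδ, hprod, map_add, hv, hmain]
      ring
    exact h
  have hδ1 : δ 1 = 0 := by
    have := orth 1 0 (by omega)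
    rw [hP.zero_eq_one] at this
    rw [hδ, Dq_one hq0 hq1, map_zero, this, sub_zero]
  have hδX : δ X = 0 := by
    have e : P 1 * X = P 1 * P 1 + C (recB u P 0) * (P 1 * P 0) := by
      rw [hP.one_eq, hP.zero_eq_one]
      ring
    have e' := hρ0
    rw [hP.zero_eq_one] at e'
    rw [hδ, Dq_X hq0 hq1, e, map_add, apply_C_mul, orth 1 0 (by omega), n1, hP.zero_eq_one,
      ← Sq_one hq0, hv, Sq_one hq0, e']
    ring
  -- Otherwise `a = b = c = 0`, which forces `an 1 = bn 1 = 0` and then `cn 1 = 0`.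
  have hπ0 : π' ≠ 0 := by
    intro h
    have c0 := congrArg (fun p => eval 0 p) h
    have c1 := congrArg (fun p => eval 1 p) h
    have c2 := congrArg (fun p => eval (-1) p) h
    simp only [hπ', eval_add, eval_mul, eval_C, eval_X, eval_pow, eval_zero] at c0 c1 c2
    have ha : a = 0 := by linear_combination (c1 + c2) / 2 - c0
    have hb : b = 0 := by
      have : b / α = 0 := by linear_combination (c1 - c2) / 2
      exact (div_eq_zero_iff.1 this).resolve_right hα
    rw [ha] at c0
    obtain ⟨i₁, i₂, i₃⟩ := hab
    -- This number is `α_2`.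
    have hα2 : 2 * α ^ 2 - 1 ≠ 0 := by
      have h1 := alphaNum_succ hq0 hq1 1
      rw [gammaNum_one hq0 hq1, ← hαdef] at h1
      have h2 := alphaNum_ne_zero hq0 (1 + 1)
      rw [h1] at h2
      intro h
      apply h2
      linear_combination h
    rw [ha] at i₁
    have a1 := (mul_eq_zero.1 i₁).resolve_right hα2
    rw [a1, hb] at i₂
    have b1 : bn 1 = 0 := by
      have := (mul_eq_zero.1 i₂).resolve_left hα
      linear_combination this
    rw [a1, b1] at i₃
    apply hcn 1
    linear_combination i₃ + c0
  intro f
  have hf : δ f = 0 := by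
    rw [← EuclideanDomain.div_add_mod f π', map_add, hδπ, zero_add]
    have hlt := degree_mod_lt f hπ0
    have hdeg : (f % π').natDegree ≤ 1 := by
      have h2 : π'.degree ≤ 2 := degree_quadratic_le
      have : (f % π').degree < 2 := hlt.trans_le h2
      exact natDegree_le_iff_coeff_eq_zero.2 fun i hi => (degree_lt_iff_coeff_zero _ 2).1 this i hi
    obtain ⟨r, s, hrs⟩ := exists_eq_X_add_C_of_natDegree_le_one hdeg
    rw [hrs, map_add, apply_C_mul, hδX, ← mul_one (C s), apply_C_mul, hδ1]
    ring
  rw [hδ, sub_eq_zero, hP.one_eq] at hf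
  exact hf

end StructureRelation

/-! ### The compatibility conditions and the explicit coefficients of `φ`. -/

section Compatibility

variable {q : ℝ} (hq0 : 0 < q) (hq1 : q < 1) {u : ℂ[X] →ₗ[ℂ] ℂ} {P : ℕ → ℂ[X]}
  (hP : IsMonicOPS u P) {a b c : ℂ} {an bn cn : ℕ → ℂ} (hcn : ∀ n, cn n ≠ 0)
  (hcond1 : a ≠ 0 →
    (4 * alphaNum q 1 ^ 2 - 1) * a * recC u P 2 * recC u P 3 +
      (cn 3 + 2 * a * recC u P 3) / 2 * ((recB u P 0 + recB u P 1) ^ 2 +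
        4 * alphaNum q 1 ^ 2 * (recC u P 1 - recB u P 0 * recB u P 1 + alphaNum q 1 ^ 2 - 1)
        - 2 * (2 * alphaNum q 1 ^ 2 - 1) * recC u P 2) = 0)
include hq0 hq1 hP hcn hcond1

/-- If `r_3 = 0` then `a ≠ 0`, since `cn 3 ≠ 0`, and the first condition collapses to `(4α² - 1) a
C_2 C_3 = 0`. This is impossible because `4α² - 1 = γ_3`. -/
theorem structure_denom_ne_zero : cn 3 + 2 * a * recC u P 3 ≠ 0 := by
  intro h
  by_cases ha : a = 0
  · rw [ha] at h
    apply hcn 3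
    linear_combination h
  · have hc := hcond1 ha
    rw [h] at hc
    have hΓ : ∀ n, recC u P n ≠ 0 := fun n => (hP.recurrence n).2
    have hα : 4 * alphaNum q 1 ^ 2 - 1 ≠ 0 := by
      have h3 := gammaNum_ne_zero hq0 hq1 (n := 3) (by norm_num)
      have e3 := gammaNum_succ hq0 hq1 2
      have e2 := gammaNum_succ hq0 hq1 1
      have f2 := alphaNum_succ hq0 hq1 1
      rw [gammaNum_one hq0 hq1] at e2 f2
      norm_num at h3 e3 e2 f2
      rw [e3, e2, f2] at h3
      intro h
      apply h3
      linear_combination h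
    have : (4 * alphaNum q 1 ^ 2 - 1) * a * recC u P 2 * recC u P 3 = 0 := by
      linear_combination hc
    exact mul_ne_zero (mul_ne_zero (mul_ne_zero hα ha) (hΓ 2)) (hΓ 3) this

variable
  (hrel : ∀ n, (C a * X ^ 2 + C b * X + C c) * Dq q (P n) =
    C (an n) * Sq q (P (n + 1)) + C (bn n) * Sq q (P n) + C (cn n) * Sq q (prev P n))
  (hcond2 : a * recC u P 2 * recC u P 3 * (bn 2 + 2 * a * recB u P 2 + b / alphaNum q 1) -
    (cn 3 + 2 * a * recC u P 3) * (a * (recB u P 2 + recB u P 1) * recC u P 2 +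
      b / alphaNum q 1 * recC u P 2 -
      (cn 2 + 2 * a * recC u P 2) / 2 * (recB u P 1 - recB u P 0)) = 0)
include hrel hcond2

/-- With `x = a C_3 / r_3`, the second condition divided by `r_3` is the case `n = 2` of the
matching, and the first one divided by `r_3` and multiplied by `an 1` is the case `n = 1`. The
stated `𝔞, 𝔟, 𝔠` are the coefficients of `-(ρ + (α² - 1) z (z - B 0)) / α`. -/
theorem pearson_of_compatibility {𝔞 𝔟 𝔠 : ℂ}
    (h𝔞 : 𝔞 = -((a * recC u P 3 + (alphaNum q 1 ^ 2 - 1) * (cn 3 + 2 * a * recC u P 3)) /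
      (alphaNum q 1 * (cn 3 + 2 * a * recC u P 3))))
    (h𝔟 : 𝔟 = -(1 / (2 * alphaNum q 1)) *
      ((1 - 2 * a * (recC u P 3 / (cn 3 + 2 * a * recC u P 3))) * (recB u P 0 + recB u P 1) -
        2 * alphaNum q 1 ^ 2 * recB u P 0))
    (h𝔠 : 𝔠 = -(1 / (2 * alphaNum q 1)) *
      ((1 - 2 * a * (recC u P 3 / (cn 3 + 2 * a * recC u P 3))) *
        (recC u P 1 - recB u P 0 * recB u P 1) + recC u P 1 + recB u P 0 ^ 2)) (f : ℂ[X]) :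
    u (pearsonOp q 𝔞 𝔟 𝔠 (recB u P 0) f) = 0 := by
  have hα := alphaNum_ne_zero hq0 1
  have hr := structure_denom_ne_zero hq0 hq1 hP hcn hcond1
  obtain ⟨-, -, i₁, i₂, i₃⟩ := structure_coeff hq0 hq1 hP hrel
  have hP2 := (hP.recurrence 1).1
  simp only [Nat.reduceAdd, prev] at hP2
  set r := cn 3 + 2 * a * recC u P 3 with hrdef
  set α := alphaNum q 1 with hαdef
  obtain ⟨x, hx⟩ : ∃ x, x = a * recC u P 3 / r := ⟨_, rfl⟩
  obtain ⟨y, hy⟩ : ∃ y, y = (recB u P 1 - recB u P 0) / 2 := ⟨_, rfl⟩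
  have hxr : x * r = a * recC u P 3 := by rw [hx, div_mul_cancel₀ _ hr]
  have hb : b / α = bn 1 - an 1 * (recB u P 0 + recB u P 1) := by
    rw [← i₂, mul_div_cancel_left₀ _ hα]
  have hΓr : a * (recC u P 3 / r) = x := by rw [hx, mul_div_assoc]
  refine pearson_of_structure hq0 hq1 hP hrel hcn hy hxr ?_ ?_ ?_ f
  · refine mul_left_cancel₀ hr ?_
    rw [← hαdef, hy]
    linear_combination hcond2 + recC u P 2 * (bn 2 + 2 * a * recB u P 2 + b / α) * hxr
  · rw [← hαdef, hb, ← i₃]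
    -- For `a = 0` also `an 1 = 0`, and the case `n = 1` holds without the first condition.
    by_cases ha : a = 0
    · have hα2 : 2 * α ^ 2 - 1 ≠ 0 := by
        have h1 := alphaNum_succ hq0 hq1 1
        rw [gammaNum_one hq0 hq1, ← hαdef] at h1
        have h2 := alphaNum_ne_zero hq0 (1 + 1)
        rw [h1] at h2
        intro h
        apply h2
        linear_combination h
      have ha1 : an 1 = 0 := by
        rw [ha] at i₁
        exact (mul_eq_zero.1 i₁).resolve_right hα2
      rw [ha1, ha, hy]
      ring
    · have hx1 : (4 * α ^ 2 - 1) * x * recC u P 2 +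
          ((recB u P 0 + recB u P 1) ^ 2 +
            4 * α ^ 2 * (recC u P 1 - recB u P 0 * recB u P 1 + α ^ 2 - 1)
            - 2 * (2 * α ^ 2 - 1) * recC u P 2) / 2 = 0 := by
        refine (mul_eq_zero.1 (Eq.trans ?_ (hcond1 ha))).resolve_left hr
        linear_combination (4 * α ^ 2 - 1) * recC u P 2 * hxr
      rw [← i₁, hy]
      linear_combination an 1 * hx1
  · have e𝔞 : α * 𝔞 = -(x + (α ^ 2 - 1)) := by
      rw [h𝔞, hx]
      field_simp
    have e𝔟 : α * 𝔟 = -(y - x * (recB u P 0 + recB u P 1) - (α ^ 2 - 1) * recB u P 0) := by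
      rw [h𝔟, mul_assoc 2 a, hΓr, hy]
      field_simp
      ring
    have e𝔠 : α * 𝔠 =
        -(recC u P 1 - y * recB u P 0 + x * (recB u P 0 * recB u P 1 - recC u P 1)) := by
      rw [h𝔠, mul_assoc 2 a, hΓr, hy]
      field_simp
      ring
    have e : C α * (C 𝔞 * X ^ 2 + C 𝔟 * X + C 𝔠) =
        C (α * 𝔞) * X ^ 2 + C (α * 𝔟) * X + C (α * 𝔠) := by
      simp only [C_mul]
      ring
    rw [← hαdef, e, e𝔞, e𝔟, e𝔠, hP2, hP.one_eq, hP.zero_eq_one]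
    simp only [map_add, map_sub, map_mul, map_one, map_pow, map_neg]
    ring

end Compatibility

/-! ### The second-order operator in the Askey-Wilson basis. -/

/-- The basis polynomial `(t w, t / w; q)_k` as a polynomial in `(w + w⁻¹) / 2`. -/
noncomputable def awBasis (q t : ℂ) (k : ℕ) : ℂ[X] :=
  ∏ j ∈ Finset.range k, (1 - C (2 * t * q ^ j) * X + C (t ^ 2 * q ^ (2 * j)))

theorem awBasis_succ (q t : ℂ) (k : ℕ) :
    awBasis q t (k + 1) =
      awBasis q t k * (1 - C (2 * t * q ^ k) * X + C (t ^ 2 * q ^ (2 * k))) :=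
  Finset.prod_range_succ _ _

theorem awBasis_succ' (q t : ℂ) (k : ℕ) :
    awBasis q t (k + 1) = (1 - C (2 * t) * X + C (t ^ 2)) * awBasis q (t * q) k := by
  rw [awBasis, Finset.prod_range_succ', mul_comm, awBasis]
  congr 1
  · simp
  · refine Finset.prod_congr rfl fun j _ => ?_
    have e₁ : 2 * t * q ^ (j + 1) = 2 * (t * q) * q ^ j := by ring
    have e₂ : t ^ 2 * q ^ (2 * (j + 1)) = (t * q) ^ 2 * q ^ (2 * j) := by ring
    rw [e₁, e₂]

theorem breve_awBasis (q t : ℂ) (k : ℕ) {w : ℂ} (hw : w ≠ 0) :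
    breve (awBasis q t k) w =
      (∏ j ∈ Finset.range k, (1 - t * q ^ j * w)) * ∏ j ∈ Finset.range k, (1 - t * q ^ j * w⁻¹) := by
  rw [breve, awBasis, eval_prod, ← Finset.prod_mul_distrib]
  refine Finset.prod_congr rfl fun j _ => ?_
  simp only [eval_add, eval_sub, eval_mul, eval_C, eval_X, eval_one]
  field_simp
  ring

theorem natDegree_awBasis_le (q t : ℂ) (k : ℕ) : (awBasis q t k).natDegree ≤ k := by
  refine (natDegree_prod_le _ _).trans ((Finset.sum_le_card_nsmul _ _ 1 fun j _ => ?_).trans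
    (by simp))
  have : (1 - C (2 * t * q ^ j) * X + C (t ^ 2 * q ^ (2 * j)) : ℂ[X]) =
      C (-(2 * t * q ^ j)) * X + C (1 + t ^ 2 * q ^ (2 * j)) := by
    simp only [map_neg, map_add, map_one]
    ring
  rw [this]
  exact natDegree_linear_le

theorem coeff_awBasis (q t : ℂ) (k : ℕ) :
    (awBasis q t k).coeff k = ∏ j ∈ Finset.range k, (-(2 * t * q ^ j)) := by
  induction k with
  | zero => simp [awBasis]
  | succ k ih =>
    have : awBasis q t (k + 1) = C (-(2 * t * q ^ k)) * (X * awBasis q t k) +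
        C (1 + t ^ 2 * q ^ (2 * k)) * awBasis q t k := by
      rw [awBasis_succ]
      simp only [map_neg, map_add, map_one]
      ring
    rw [this, coeff_add, coeff_C_mul, coeff_C_mul, coeff_X_mul, ih, Finset.prod_range_succ,
      coeff_eq_zero_of_natDegree_lt ((natDegree_awBasis_le q t k).trans_lt k.lt_succ_self)]
    ring

/-- The relation between the coefficients of the second-order equation and the parameters
of the Askey-Wilson polynomials. -/
def ParamRel (q : ℝ) (𝔞 𝔟 𝔠 β t₁ t₂ t₃ t₄ : ℂ) : Prop :=
  ∃ K : ℂ, K * (t₁ * t₂ * t₃ * t₄ - 1) = qPow q (1 / 2) - (qPow q (1 / 2))⁻¹ ∧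
    2 * 𝔞 = K * (t₁ * t₂ * t₃ * t₄ + 1) ∧
    4 * 𝔟 = -(K * (t₁ + t₂ + t₃ + t₄ +
      (t₁ * t₂ * t₃ + t₁ * t₂ * t₄ + t₁ * t₃ * t₄ + t₂ * t₃ * t₄))) ∧
    4 * 𝔠 = K * (t₁ * t₂ + t₁ * t₃ + t₁ * t₄ + t₂ * t₃ + t₂ * t₄ + t₃ * t₄ -
      t₁ * t₂ * t₃ * t₄ - 1) ∧
    2 * (qPow q (1 / 2) - (qPow q (1 / 2))⁻¹) * β =
      K * (t₁ * t₂ * t₃ + t₁ * t₂ * t₄ + t₁ * t₃ * t₄ + t₂ * t₃ * t₄ - (t₁ + t₂ + t₃ + t₄))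

/-- This is the succeeding-index case of `pearsonOp_Dq_awBasis` at a point `x`, after removal of the
common factor `awBasis q (t₁ * q) k`, with `Q` standing for `q^{k+1}`. Once denominators are cleared
(`core`), it is a linear combination of the parameter relations. -/
theorem param_identity {K κ s q Q x 𝔞 𝔟 𝔠 β t₁ t₂ t₃ t₄ : ℂ} (hs : s ≠ 0) (hκ : κ ≠ 0)
    (hQ : Q ≠ 0) (hq : q ≠ 0) (hsq : s ^ 2 = q)
    (hK : K * (t₁ * t₂ * t₃ * t₄ - 1) = κ) (e𝔞 : 2 * 𝔞 = K * (t₁ * t₂ * t₃ * t₄ + 1))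
    (e𝔟 : 4 * 𝔟 = -(K * (t₁ + t₂ + t₃ + t₄ +
      (t₁ * t₂ * t₃ + t₁ * t₂ * t₄ + t₁ * t₃ * t₄ + t₂ * t₃ * t₄))))
    (e𝔠 : 4 * 𝔠 = K * (t₁ * t₂ + t₁ * t₃ + t₁ * t₄ + t₂ * t₃ + t₂ * t₄ + t₃ * t₄ -
      t₁ * t₂ * t₃ * t₄ - 1))
    (eβ : 2 * κ * β =
      K * (t₁ * t₂ * t₃ + t₁ * t₂ * t₄ + t₁ * t₃ * t₄ + t₂ * t₃ * t₄ - (t₁ + t₂ + t₃ + t₄))) :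
    2 * t₁ * (s⁻¹ - s * Q) / κ * ((𝔞 * x ^ 2 + 𝔟 * x + 𝔠) *
        (2 * (t₁ * s) * (s⁻¹ - s * (Q / q)) / κ) +
      (x - β) * (1 + (t₁ * s) ^ 2 * (Q / q) - t₁ * s * (s * (Q / q) + s⁻¹) * x)) =
    (1 - 2 * t₁ * x + t₁ ^ 2) *
      (K / (s * κ ^ 2) * (1 - Q * q) * (q - t₁ * t₂ * t₃ * t₄ * (Q * q)) / (Q * q) *
        (1 - 2 * t₁ * Q * x + t₁ ^ 2 * Q ^ 2) -
      K / (s * κ ^ 2) * (1 - Q * q) *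
        ((1 - t₁ * t₂ * Q) * (1 - t₁ * t₃ * Q) * (1 - t₁ * t₄ * Q)) / Q) := by
  have core : 2 * t₁ * Q * (2 * t₁ * (1 - Q) * (𝔞 * x ^ 2 + 𝔟 * x + 𝔠) +
      κ * (x - β) * (1 + t₁ ^ 2 * Q - t₁ * (Q + 1) * x)) =
      (1 - 2 * t₁ * x + t₁ ^ 2) * K * ((1 - t₁ * t₂ * t₃ * t₄ * Q) *
        (1 - 2 * t₁ * Q * x + t₁ ^ 2 * Q ^ 2) -
        (1 - t₁ * t₂ * Q) * (1 - t₁ * t₃ * Q) * (1 - t₁ * t₄ * Q)) := by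
    linear_combination (2 * t₁ ^ 2 * Q * (1 - Q) * x ^ 2) * e𝔞 + t₁ ^ 2 * Q * (1 - Q) * x * e𝔟 +
      t₁ ^ 2 * Q * (1 - Q) * e𝔠 -
      2 * t₁ * Q * x * (1 + t₁ ^ 2 * Q - t₁ * (Q + 1) * x) * hK -
      t₁ * Q * (1 + t₁ ^ 2 * Q - t₁ * (Q + 1) * x) * eβ
  have hl : s ^ 2 * (Q / q) = Q := by rw [hsq, mul_div_cancel₀ _ hq]
  have e₁ : 2 * t₁ * (s⁻¹ - s * Q) / κ = 2 * t₁ * (1 - Q * q) / (s * κ) := by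
    rw [← hsq]
    field_simp
  have e₂ : 2 * (t₁ * s) * (s⁻¹ - s * (Q / q)) / κ = 2 * t₁ * (1 - Q) / κ := by
    congr 1
    have : s * s⁻¹ = 1 := mul_inv_cancel₀ hs
    linear_combination 2 * t₁ * this - 2 * t₁ * hl
  have e₃ : 1 + (t₁ * s) ^ 2 * (Q / q) - t₁ * s * (s * (Q / q) + s⁻¹) * x =
      1 + t₁ ^ 2 * Q - t₁ * (Q + 1) * x := by
    have : s * s⁻¹ = 1 := mul_inv_cancel₀ hs
    linear_combination t₁ ^ 2 * hl - t₁ * x * (hl + this)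
  rw [e₁, e₂, e₃]
  have e₄ : K / (s * κ ^ 2) * (1 - Q * q) * (q - t₁ * t₂ * t₃ * t₄ * (Q * q)) / (Q * q) =
      K / (s * κ ^ 2) * (1 - Q * q) * (1 - t₁ * t₂ * t₃ * t₄ * Q) / Q := by
    field_simp
  rw [e₄]
  have e₅ : 2 * t₁ * (1 - Q * q) / (s * κ) * ((𝔞 * x ^ 2 + 𝔟 * x + 𝔠) * (2 * t₁ * (1 - Q) / κ) +
      (x - β) * (1 + t₁ ^ 2 * Q - t₁ * (Q + 1) * x)) =
      (1 - Q * q) / (s * κ ^ 2 * Q) * (2 * t₁ * Q * (2 * t₁ * (1 - Q) * (𝔞 * x ^ 2 + 𝔟 * x + 𝔠) +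
      κ * (x - β) * (1 + t₁ ^ 2 * Q - t₁ * (Q + 1) * x))) := by
    generalize 𝔞 * x ^ 2 + 𝔟 * x + 𝔠 = φ
    generalize (1 + t₁ ^ 2 * Q - t₁ * (Q + 1) * x) = l
    field_simp
  rw [e₅, core]
  field_simp

section Operators

variable {q : ℝ} (hq0 : 0 < q) (hq1 : q < 1)
include hq0

/-- As `q = s²` with `s = q^{1/2}`, both half-shifts of `w` send the product to the basis element
with parameter `t s` and one index less, times two leftover linear factors. The actions of `𝒮` and
`𝒟` on the basis follow. -/
theorem breve_awBasis_succ (t : ℂ) (k : ℕ) {w : ℂ} (hw : w ≠ 0) :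
    breve (awBasis q t (k + 1)) (qPow q (1 / 2) * w) =
        breve (awBasis q (t * qPow q (1 / 2)) k) w *
          ((1 - t * qPow q (1 / 2) * q ^ k * w) * (1 - t * (qPow q (1 / 2))⁻¹ * w⁻¹)) ∧
      breve (awBasis q t (k + 1)) ((qPow q (1 / 2))⁻¹ * w) =
        breve (awBasis q (t * qPow q (1 / 2)) k) w *
          ((1 - t * qPow q (1 / 2) * q ^ k * w⁻¹) * (1 - t * (qPow q (1 / 2))⁻¹ * w)) := by
  have hs := qPow_ne_zero hq0 (1 / 2)
  have hsq := qPow_half_sq hq0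
  generalize qPow q (1 / 2) = s at *
  rw [breve_awBasis _ _ _ (mul_ne_zero hs hw), breve_awBasis _ _ _ (mul_ne_zero (inv_ne_zero hs) hw),
    breve_awBasis _ _ _ hw]
  have e₁ : ∀ z : ℂ, ∏ j ∈ Finset.range (k + 1), (1 - t * (q : ℂ) ^ j * (s * z)) =
      (∏ j ∈ Finset.range k, (1 - t * s * (q : ℂ) ^ j * z)) * (1 - t * s * q ^ k * z) := fun z => by
    rw [Finset.prod_range_succ]
    congr 1
    · exact Finset.prod_congr rfl fun j _ => by ring
    · ring
  have e₂ : ∀ z : ℂ, ∏ j ∈ Finset.range (k + 1), (1 - t * (q : ℂ) ^ j * (s⁻¹ * z)) =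
      (∏ j ∈ Finset.range k, (1 - t * s * (q : ℂ) ^ j * z)) * (1 - t * s⁻¹ * z) := fun z => by
    rw [Finset.prod_range_succ']
    congr 1
    · refine Finset.prod_congr rfl fun j _ => ?_
      rw [pow_succ, ← hsq]
      field_simp
    · ring
  rw [mul_inv, mul_inv, inv_inv, e₁, e₂, e₁, e₂]
  constructor <;> ring

theorem Sq_awBasis_succ (t : ℂ) (k : ℕ) :
    Sq q (awBasis q t (k + 1)) = awBasis q (t * qPow q (1 / 2)) k *
      (C (1 + t ^ 2 * q ^ k) - C (t * (qPow q (1 / 2) * q ^ k + (qPow q (1 / 2))⁻¹)) * X) := by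
  refine Sq_eq hq0 fun w hw => ?_
  obtain ⟨h₁, h₂⟩ := breve_awBasis_succ hq0 t k hw
  have hs := qPow_ne_zero hq0 (1 / 2)
  rw [qPow_neg hq0, h₁, h₂, breve, eval_mul, ← breve]
  simp only [eval_sub, eval_mul, eval_C, eval_X]
  field_simp
  ring

include hq1

theorem Dq_awBasis_succ (t : ℂ) (k : ℕ) :
    Dq q (awBasis q t (k + 1)) =
      C (2 * t * ((qPow q (1 / 2))⁻¹ - qPow q (1 / 2) * q ^ k) /
        (qPow q (1 / 2) - (qPow q (1 / 2))⁻¹)) * awBasis q (t * qPow q (1 / 2)) k := by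
  refine Dq_eq hq0 hq1 fun w hw => ?_
  obtain ⟨h₁, h₂⟩ := breve_awBasis_succ hq0 t k hw
  have hs := qPow_ne_zero hq0 (1 / 2)
  have hκ := qPow_half_sub_inv_ne_zero hq0 hq1
  have hE : breve X (qPow q (1 / 2) * w) - breve X (qPow q (-(1 / 2)) * w) =
      (qPow q (1 / 2) - (qPow q (1 / 2))⁻¹) * (w - w⁻¹) / 2 := by
    rw [qPow_neg hq0]
    simp only [breve, eval_X]
    field_simp
    ring
  rw [hE, qPow_neg hq0, h₁, h₂, breve, breve, eval_mul, eval_C]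
  generalize qPow q (1 / 2) = s at *
  generalize eval ((w + w⁻¹) / 2) (awBasis (q : ℂ) (t * s) k) = A
  have : 2 * t * (s⁻¹ - s * (q : ℂ) ^ k) / (s - s⁻¹) * A * ((s - s⁻¹) * (w - w⁻¹) / 2) =
      t * (s⁻¹ - s * (q : ℂ) ^ k) * A * (w - w⁻¹) := by
    generalize s - s⁻¹ = κ at *
    field_simp
  rw [this]
  field_simp
  ring

variable {𝔞 𝔟 𝔠 β t₁ t₂ t₃ t₄ : ℂ}

/-- The operator is bidiagonal in this basis, with the eigenvalues on the diagonal. The eigenvalue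
equation thereby becomes a two-term recurrence for the coefficients, solved by the `₄φ₃` terms. -/
theorem pearsonOp_Dq_awBasis (h : ParamRel q 𝔞 𝔟 𝔠 β t₁ t₂ t₃ t₄) :
    ∃ ω : ℂ, (∀ n : ℕ, eigenNum q 𝔞 n =
        ω * (1 - (q : ℂ) ^ n) * (q - t₁ * t₂ * t₃ * t₄ * q ^ n) / q ^ n) ∧
      ∀ n : ℕ, pearsonOp q 𝔞 𝔟 𝔠 β (Dq q (awBasis q t₁ (n + 1))) =
        C (eigenNum q 𝔞 (n + 1)) * awBasis q t₁ (n + 1) -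
        C (ω * (1 - (q : ℂ) ^ (n + 1)) * ((1 - t₁ * t₂ * q ^ n) * (1 - t₁ * t₃ * q ^ n) *
          (1 - t₁ * t₄ * q ^ n)) / q ^ n) * awBasis q t₁ n := by
  obtain ⟨K, hK, e𝔞, e𝔟, e𝔠, eβ⟩ := h
  have hs := qPow_ne_zero hq0 (1 / 2)
  have hκ := qPow_half_sub_inv_ne_zero hq0 hq1
  have hsq := qPow_half_sq hq0
  have hqc : (q : ℂ) ≠ 0 := by exact_mod_cast hq0.ne'
  set s := qPow q (1 / 2) with hsdef
  set κ := s - s⁻¹ with hκdef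
  have hω : ∀ n : ℕ, eigenNum q 𝔞 n =
      K / (s * κ ^ 2) * (1 - (q : ℂ) ^ n) * (q - t₁ * t₂ * t₃ * t₄ * q ^ n) / q ^ n := by
    intro n
    have hy := zpow_ne_zero (n : ℤ) hs
    rw [eigenNum, gammaNum_eq hq0, gammaNum_eq hq0, alphaNum_eq hq0, ← hsdef, ← hκdef,
      zpow_sub_one₀ hs]
    have hqn : (q : ℂ) ^ n = (s ^ (n : ℤ)) ^ 2 := by
      rw [← hsq, zpow_natCast]
      ring
    rw [hqn]
    generalize s ^ (n : ℤ) = y at *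
    have h1 : 𝔞 * ((y * s⁻¹ - (y * s⁻¹)⁻¹) / κ) + (y * s⁻¹ + (y * s⁻¹)⁻¹) / 2 =
        K * (t₁ * t₂ * t₃ * t₄ * (y * s⁻¹) - (y * s⁻¹)⁻¹) / κ := by
      field_simp
      linear_combination (y ^ 2 - s ^ 2) * e𝔞 - (y ^ 2 + s ^ 2) * hK
    rw [h1, ← hsq]
    field_simp
    ring
  refine ⟨K / (s * κ ^ 2), hω, fun n => ?_⟩
  rw [hω]
  -- The first index is separate: there `𝒟` already yields a constant, to which `Dq_awBasis_succ`
  -- does not apply a second time.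
  cases n with
  | zero =>
    have hc : 2 * t₁ * (s⁻¹ - s * (q : ℂ) ^ 0) / κ = -(2 * t₁) := by
      rw [pow_zero, div_eq_iff hκ, hκdef]
      ring
    have h1 : K / (s * κ ^ 2) * (1 - (q : ℂ) ^ (0 + 1)) = -(K / κ) := by
      have : 1 - s ^ 2 = -(s * κ) := by
        rw [hκdef]
        field_simp
        ring
      rw [zero_add, pow_one, ← hsq, this]
      field_simp
    have h2 : -(K / κ) * ((q : ℂ) - t₁ * t₂ * t₃ * t₄ * q ^ (0 + 1)) / q ^ (0 + 1) = 1 := by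
      have : (q : ℂ) - t₁ * t₂ * t₃ * t₄ * q ^ (0 + 1) =
        -((t₁ * t₂ * t₃ * t₄ - 1) * q) := by ring
      rw [this, zero_add, pow_one]
      field_simp
      linear_combination hK
    have h3 : 2 * t₁ * β = 1 + t₁ ^ 2 +
        K / κ * ((1 - t₁ * t₂) * (1 - t₁ * t₃) * (1 - t₁ * t₄)) := by
      field_simp
      clear_value κ
      linear_combination t₁ * eβ + (1 + t₁ ^ 2) * hK
    rw [Dq_awBasis_succ hq0 hq1, ← hsdef, ← hκdef, hc, h1, h2, pearsonOp_C_mul hq0 hq1]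
    have hA : ∀ t, awBasis (q : ℂ) t 0 = 1 := fun t => by simp [awBasis]
    rw [awBasis_succ, hA, hA, pearsonOp, Dq_one hq0 hq1, Sq_one hq0]
    apply Polynomial.funext
    intro x
    simp only [eval_add, eval_sub, eval_mul, eval_C, eval_X, eval_one, eval_zero, pow_zero]
    linear_combination h3
  | succ k =>
    have hQ : (q : ℂ) ^ (k + 1) ≠ 0 := pow_ne_zero _ hqc
    have hQq : (q : ℂ) ^ k = q ^ (k + 1) / q := by
      rw [pow_succ, mul_div_cancel_right₀ _ hqc]
    have hss : t₁ * s * s = t₁ * q := by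
      rw [← hsq]
      ring
    rw [Dq_awBasis_succ hq0 hq1, ← hsdef, ← hκdef, pearsonOp_C_mul hq0 hq1, pearsonOp,
      Dq_awBasis_succ hq0 hq1, Sq_awBasis_succ hq0, ← hsdef, ← hκdef, hss, awBasis_succ' _ t₁ (k + 1),
      awBasis_succ' _ t₁ k, awBasis_succ _ (t₁ * q) k, hQq, pow_succ (q : ℂ) (k + 1)]
    have e₁ : 2 * (t₁ * q) * (q : ℂ) ^ k = 2 * t₁ * q ^ (k + 1) := by ring
    have e₂ : (t₁ * q) ^ 2 * (q : ℂ) ^ (2 * k) = t₁ ^ 2 * (q ^ (k + 1)) ^ 2 := by ring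
    rw [hQq] at e₁
    rw [e₁, e₂]
    generalize (q : ℂ) ^ (k + 1) = Q at *
    apply Polynomial.funext
    intro x
    have hid := param_identity (x := x) hs hκ hQ hqc hsq hK e𝔞 e𝔟 e𝔠 eβ
    simp only [eval_add, eval_sub, eval_mul, eval_C, eval_X, eval_one, eval_pow]
    linear_combination eval x (awBasis (q : ℂ) (t₁ * q) k) * hid

end Operators

/-! ### Askey-Wilson polynomials as monic eigenpolynomials. -/

theorem qPoch_succ (x q : ℂ) (n : ℕ) : qPoch x q (n + 1) = qPoch x q n * (1 - x * q ^ n) :=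
  Finset.prod_range_succ _ _

theorem qPoch_ne_zero {x q : ℂ} {n : ℕ} (h : ∀ j < n, 1 - x * q ^ j ≠ 0) : qPoch x q n ≠ 0 :=
  Finset.prod_ne_zero_iff.2 fun j hj => h j (Finset.mem_range.1 hj)

theorem AdmissibleParams.ne {q t₁ t₂ t₃ t₄ : ℂ} (h : AdmissibleParams q t₁ t₂ t₃ t₄) (n : ℕ) :
    1 - t₁ * t₂ * t₃ * t₄ * q ^ n ≠ 0 ∧ 1 - t₁ * t₂ * q ^ n ≠ 0 ∧ 1 - t₁ * t₃ * q ^ n ≠ 0 ∧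
      1 - t₁ * t₄ * q ^ n ≠ 0 := by
  have h := h.2 n
  simp only [mul_ne_zero_iff] at h
  tauto

/-- The coefficient of `awBasis q t₁ k` in the `₄φ₃`-representation. -/
noncomputable def awCoeff (q t₁ t₂ t₃ t₄ : ℂ) (n k : ℕ) : ℂ :=
  qPoch (q ^ (-(n : ℤ))) q k * qPoch (t₁ * t₂ * t₃ * t₄ * q ^ ((n : ℤ) - 1)) q k /
    (qPoch (t₁ * t₂) q k * qPoch (t₁ * t₃) q k * qPoch (t₁ * t₄) q k * qPoch q q k) * q ^ k

theorem one_sub_pow_succ_ne_zero {q : ℝ} (hq0 : 0 < q) (hq1 : q < 1) (n : ℕ) :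
    1 - (q : ℂ) ^ (n + 1) ≠ 0 := by
  have h : q ^ (n + 1) < 1 := pow_lt_one₀ hq0.le hq1 (Nat.succ_ne_zero n)
  have : (1 : ℝ) - q ^ (n + 1) ≠ 0 := by linarith
  exact_mod_cast this

section

variable {q : ℝ} (hq0 : 0 < q) (hq1 : q < 1) {t₁ t₂ t₃ t₄ : ℂ}
  (ht : AdmissibleParams (q : ℂ) t₁ t₂ t₃ t₄)
include hq0 hq1 ht

/-- The term ratio of the `₄φ₃` series, cross-multiplied to match the two-term recurrence. -/
theorem awCoeff_succ (n k : ℕ) :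
    awCoeff q t₁ t₂ t₃ t₄ n (k + 1) * ((1 - t₁ * t₂ * q ^ k) * (1 - t₁ * t₃ * q ^ k) *
        (1 - t₁ * t₄ * q ^ k) * (1 - (q : ℂ) ^ (k + 1))) =
      awCoeff q t₁ t₂ t₃ t₄ n k * ((1 - (q : ℂ) ^ (-(n : ℤ)) * q ^ k) *
        (1 - t₁ * t₂ * t₃ * t₄ * q ^ ((n : ℤ) - 1) * q ^ k) * q) := by
  have h₂ : ∀ j, qPoch (t₁ * t₂) q j ≠ 0 := fun j => qPoch_ne_zero fun i _ => (ht.ne i).2.1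
  have h₃ : ∀ j, qPoch (t₁ * t₃) q j ≠ 0 := fun j => qPoch_ne_zero fun i _ => (ht.ne i).2.2.1
  have h₄ : ∀ j, qPoch (t₁ * t₄) q j ≠ 0 := fun j => qPoch_ne_zero fun i _ => (ht.ne i).2.2.2
  have h₅ : ∀ j, qPoch (q : ℂ) q j ≠ 0 := fun j => qPoch_ne_zero fun i _ => by
    rw [← pow_succ']
    exact one_sub_pow_succ_ne_zero hq0 hq1 i
  obtain ⟨-, k₂, k₃, k₄⟩ := ht.ne k
  have k₅ := one_sub_pow_succ_ne_zero hq0 hq1 k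
  have e : (q : ℂ) * q ^ k = q ^ (k + 1) := (pow_succ' _ _).symm
  rw [awCoeff, awCoeff]
  simp only [qPoch_succ]
  rw [e]
  have g₂ := h₂ k
  have g₃ := h₃ k
  have g₄ := h₄ k
  have g₅ := h₅ k
  generalize qPoch (t₁ * t₂) (q : ℂ) k = p₂ at *
  generalize qPoch (t₁ * t₃) (q : ℂ) k = p₃ at *
  generalize qPoch (t₁ * t₄) (q : ℂ) k = p₄ at *
  generalize qPoch (q : ℂ) (q : ℂ) k = p₅ at *
  generalize qPoch ((q : ℂ) ^ (-(n : ℤ))) (q : ℂ) k = p₀ at *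
  generalize qPoch (t₁ * t₂ * t₃ * t₄ * (q : ℂ) ^ ((n : ℤ) - 1)) (q : ℂ) k = p₁ at *
  generalize (1 - (q : ℂ) ^ (-(n : ℤ)) * q ^ k) = y₀ at *
  generalize (1 - t₁ * t₂ * t₃ * t₄ * (q : ℂ) ^ ((n : ℤ) - 1) * q ^ k) = y₁ at *
  generalize (1 - t₁ * t₂ * (q : ℂ) ^ k) = y₂ at *
  generalize (1 - t₁ * t₃ * (q : ℂ) ^ k) = y₃ at *
  generalize (1 - t₁ * t₄ * (q : ℂ) ^ k) = y₄ at *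
  generalize (1 - (q : ℂ) ^ (k + 1)) = y₅ at *
  rw [pow_succ]
  field_simp

variable {𝔞 𝔟 𝔠 β : ℂ}

/-- The second-order equation of the Askey-Wilson polynomials. -/
theorem pearsonOp_Dq_askeyWilsonPoly (h : ParamRel q 𝔞 𝔟 𝔠 β t₁ t₂ t₃ t₄) (n : ℕ) :
    pearsonOp q 𝔞 𝔟 𝔠 β (Dq q (askeyWilsonPoly q t₁ t₂ t₃ t₄ n)) =
      C (eigenNum q 𝔞 n) * askeyWilsonPoly q t₁ t₂ t₃ t₄ n := by
  have hqc : (q : ℂ) ≠ 0 := by exact_mod_cast hq0.ne'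
  obtain ⟨ω, hω, hrec⟩ := pearsonOp_Dq_awBasis hq0 hq1 h
  -- Telescoping: a truncated sum is an eigenfunction up to one multiple of the last basis element.
  -- The subdiagonal contribution of the next term cancels that multiple (`hc`), and at `N = n` it
  -- vanishes.
  have hpart : ∀ N : ℕ, pearsonOp q 𝔞 𝔟 𝔠 β (Dq q (∑ k ∈ Finset.range (N + 1),
      C (awCoeff q t₁ t₂ t₃ t₄ n k) * awBasis q t₁ k)) =
      C (eigenNum q 𝔞 n) * ∑ k ∈ Finset.range (N + 1),
        C (awCoeff q t₁ t₂ t₃ t₄ n k) * awBasis q t₁ k +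
      C (awCoeff q t₁ t₂ t₃ t₄ n N * (eigenNum q 𝔞 N - eigenNum q 𝔞 n)) * awBasis q t₁ N := by
    intro N
    induction N with
    | zero =>
      have hS0 : Sq q 0 = 0 := by simpa using Sq_C hq0 0
      have hD0 : Dq q 0 = 0 := by simpa using Dq_C hq0 hq1 0
      have h0 : eigenNum q 𝔞 0 = 0 := by simp [eigenNum, gammaNum_zero]
      have hb : awBasis (q : ℂ) t₁ 0 = 1 := by simp [awBasis]
      rw [zero_add, Finset.sum_range_one, hb, Dq_C_mul hq0 hq1, Dq_one hq0 hq1, mul_zero, pearsonOp,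
        hS0, hD0, h0]
      simp only [map_mul, map_sub, map_zero]
      ring
    | succ N ih =>
      have hc : awCoeff q t₁ t₂ t₃ t₄ n (N + 1) * (ω * (1 - (q : ℂ) ^ (N + 1)) *
          ((1 - t₁ * t₂ * q ^ N) * (1 - t₁ * t₃ * q ^ N) * (1 - t₁ * t₄ * q ^ N)) / q ^ N) =
          awCoeff q t₁ t₂ t₃ t₄ n N * (eigenNum q 𝔞 N - eigenNum q 𝔞 n) := by
        have h1 := awCoeff_succ hq0 hq1 ht n N
        have h2 : eigenNum q 𝔞 N - eigenNum q 𝔞 n = ω / q ^ N *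
            ((1 - (q : ℂ) ^ (-(n : ℤ)) * q ^ N) *
              (1 - t₁ * t₂ * t₃ * t₄ * q ^ ((n : ℤ) - 1) * q ^ N) * q) := by
          rw [hω, hω, zpow_neg, zpow_sub_one₀ hqc, zpow_natCast]
          have hn : (q : ℂ) ^ n ≠ 0 := pow_ne_zero _ hqc
          have hN : (q : ℂ) ^ N ≠ 0 := pow_ne_zero _ hqc
          generalize (q : ℂ) ^ n = x at *
          generalize (q : ℂ) ^ N = y at *
          field_simp
          ring
        rw [h2]
        linear_combination ω / q ^ N * h1
      rw [Finset.sum_range_succ, Dq_add hq0 hq1, pearsonOp_add hq0 hq1, ih, Dq_C_mul hq0 hq1,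
        pearsonOp_C_mul hq0 hq1, hrec, ← hc]
      simp only [C_mul, C_sub]
      ring
  have hn := hpart n
  rw [sub_self, mul_zero, map_zero, zero_mul, add_zero] at hn
  have hQ : askeyWilsonPoly q t₁ t₂ t₃ t₄ n =
      C (qPoch (t₁ * t₂) q n * qPoch (t₁ * t₃) q n * qPoch (t₁ * t₄) q n /
      ((2 * t₁) ^ n * qPoch (t₁ * t₂ * t₃ * t₄ * (q : ℂ) ^ ((n : ℤ) - 1)) q n)) *
      ∑ k ∈ Finset.range (n + 1), C (awCoeff q t₁ t₂ t₃ t₄ n k) * awBasis q t₁ k := rfl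
  rw [hQ, Dq_C_mul hq0 hq1, pearsonOp_C_mul hq0 hq1, hn]
  ring

omit hq0 hq1 ht in
theorem natDegree_askeyWilsonPoly_le (n : ℕ) :
    (askeyWilsonPoly q t₁ t₂ t₃ t₄ n).natDegree ≤ n := by
  refine (natDegree_C_mul_le _ _).trans (natDegree_sum_le_of_forall_le _ _ fun k hk => ?_)
  exact (natDegree_C_mul_le _ _).trans ((natDegree_awBasis_le _ _ k).trans
    (Nat.lt_succ_iff.1 (Finset.mem_range.1 hk)))

theorem coeff_askeyWilsonPoly (n : ℕ) : (askeyWilsonPoly q t₁ t₂ t₃ t₄ n).coeff n = 1 := by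
  have hqc : (q : ℂ) ≠ 0 := by exact_mod_cast hq0.ne'
  have hQ : askeyWilsonPoly q t₁ t₂ t₃ t₄ n =
      C (qPoch (t₁ * t₂) q n * qPoch (t₁ * t₃) q n * qPoch (t₁ * t₄) q n /
      ((2 * t₁) ^ n * qPoch (t₁ * t₂ * t₃ * t₄ * (q : ℂ) ^ ((n : ℤ) - 1)) q n)) *
      ∑ k ∈ Finset.range (n + 1), C (awCoeff q t₁ t₂ t₃ t₄ n k) * awBasis q t₁ k := rfl
  have hsum : (∑ k ∈ Finset.range (n + 1),
      C (awCoeff q t₁ t₂ t₃ t₄ n k) * awBasis (q : ℂ) t₁ k).coeff n =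
      awCoeff q t₁ t₂ t₃ t₄ n n * ∏ j ∈ Finset.range n, (-(2 * t₁ * (q : ℂ) ^ j)) := by
    rw [finsetSum_coeff, Finset.sum_range_succ, coeff_C_mul, coeff_awBasis,
      Finset.sum_eq_zero, zero_add]
    intro k hk
    rw [coeff_C_mul, coeff_eq_zero_of_natDegree_lt
      ((natDegree_awBasis_le _ _ k).trans_lt (Finset.mem_range.1 hk)), mul_zero]
  have hprod : qPoch ((q : ℂ) ^ (-(n : ℤ))) q n * q ^ n *
      ∏ j ∈ Finset.range n, (-(2 * t₁ * (q : ℂ) ^ j)) = (2 * t₁) ^ n * qPoch q q n := by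
    have e₁ : qPoch ((q : ℂ) ^ (-(n : ℤ))) q n =
        ∏ j ∈ Finset.range n, (1 - ((q : ℂ) ^ (j + 1))⁻¹) := by
      rw [qPoch, ← Finset.prod_range_reflect]
      refine Finset.prod_congr rfl fun j hj => ?_
      have hj := Finset.mem_range.1 hj
      obtain ⟨d, rfl⟩ : ∃ d, n = j + 1 + d := ⟨n - (j + 1), by omega⟩
      have hd : j + 1 + d - 1 - j = d := by omega
      rw [hd, zpow_neg, zpow_natCast, pow_add]
      field_simp
    have e₂ : ∀ x : ℂ, x ^ n = ∏ _j ∈ Finset.range n, x := fun x => by simp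
    rw [e₁, e₂ (q : ℂ), e₂ (2 * t₁), qPoch, ← Finset.prod_mul_distrib, ← Finset.prod_mul_distrib,
      ← Finset.prod_mul_distrib]
    refine Finset.prod_congr rfl fun j _ => ?_
    rw [pow_succ]
    field_simp
    ring
  have h₂ : qPoch (t₁ * t₂) q n ≠ 0 := qPoch_ne_zero fun i _ => (ht.ne i).2.1
  have h₃ : qPoch (t₁ * t₃) q n ≠ 0 := qPoch_ne_zero fun i _ => (ht.ne i).2.2.1
  have h₄ : qPoch (t₁ * t₄) q n ≠ 0 := qPoch_ne_zero fun i _ => (ht.ne i).2.2.2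
  have h₅ : qPoch (q : ℂ) q n ≠ 0 := qPoch_ne_zero fun i _ => by
    rw [← pow_succ']
    exact one_sub_pow_succ_ne_zero hq0 hq1 i
  -- The exponent `n - 1` is negative only for `n = 0`, when the product is empty; otherwise only
  -- natural powers of `q` occur, which admissibility covers.
  have h₆ : qPoch (t₁ * t₂ * t₃ * t₄ * (q : ℂ) ^ ((n : ℤ) - 1)) q n ≠ 0 :=
    qPoch_ne_zero fun i hi => by
      obtain ⟨m, rfl⟩ : ∃ m, n = m + 1 := ⟨n - 1, by omega⟩
      have := (ht.ne (m + i)).1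
      rw [pow_add, ← mul_assoc] at this
      push_cast
      rwa [add_sub_cancel_right, zpow_natCast]
  have h₁ : (2 * t₁) ^ n ≠ 0 := pow_ne_zero _ (mul_ne_zero two_ne_zero ht.1)
  rw [hQ, coeff_C_mul, hsum, awCoeff]
  generalize ∏ j ∈ Finset.range n, (-(2 * t₁ * (q : ℂ) ^ j)) = R at *
  generalize qPoch (t₁ * t₂) (q : ℂ) n = p₂ at *
  generalize qPoch (t₁ * t₃) (q : ℂ) n = p₃ at *
  generalize qPoch (t₁ * t₄) (q : ℂ) n = p₄ at *
  generalize qPoch (q : ℂ) (q : ℂ) n = p₅ at *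
  generalize qPoch ((q : ℂ) ^ (-(n : ℤ))) (q : ℂ) n = p₀ at *
  generalize qPoch (t₁ * t₂ * t₃ * t₄ * (q : ℂ) ^ ((n : ℤ) - 1)) (q : ℂ) n = p₁ at *
  generalize (2 * t₁) ^ n = T at *
  field_simp
  linear_combination hprod

end

/-! ### Continuity of eigenpolynomials in the coefficients of the equation. -/

section Limit

open Filter Topology

variable {q : ℝ} (hq0 : 0 < q) (hq1 : q < 1)
include hq0 hq1

theorem coeff_pearsonOp_Dq_eq_sum (𝔞 𝔟 𝔠 β : ℂ) {f : ℂ[X]} {n : ℕ} (hf : f.natDegree ≤ n) (i : ℕ) :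
    (pearsonOp q 𝔞 𝔟 𝔠 β (Dq q f)).coeff i =
      ∑ j ∈ Finset.range (n + 1), f.coeff j * (pearsonOp q 𝔞 𝔟 𝔠 β (Dq q (X ^ j))).coeff i := by
  let M : ℂ[X] →ₗ[ℂ] ℂ :=
    { toFun := fun f => (pearsonOp q 𝔞 𝔟 𝔠 β (Dq q f)).coeff i
      map_add' := fun f g => by
        simp only [Dq_add hq0 hq1, pearsonOp_add hq0 hq1, coeff_add]
      map_smul' := fun a f => by
        simp only [smul_eq_C_mul, Dq_C_mul hq0 hq1, pearsonOp_C_mul hq0 hq1, coeff_C_mul,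
          RingHom.id_apply, smul_eq_mul] }
  change M f = ∑ j ∈ Finset.range (n + 1), f.coeff j * M (X ^ j)
  conv_lhs => rw [as_sum_range_C_mul_X_pow' f (Nat.lt_succ_of_le hf)]
  rw [map_sum]
  exact Finset.sum_congr rfl fun j _ => apply_C_mul M _ _

/-- The coefficients of a monic eigenpolynomial are determined recursively. -/
theorem eigenpoly_coeff {𝔞 𝔟 𝔠 β : ℂ} {f : ℂ[X]} {n : ℕ} (hf : f.natDegree ≤ n)
    (h : pearsonOp q 𝔞 𝔟 𝔠 β (Dq q f) = C (eigenNum q 𝔞 n) * f) {i : ℕ} (hi : i < n) :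
    (eigenNum q 𝔞 n - eigenNum q 𝔞 i) * f.coeff i =
      ∑ j ∈ Finset.Ico (i + 1) (n + 1),
        f.coeff j * (pearsonOp q 𝔞 𝔟 𝔠 β (Dq q (X ^ j))).coeff i := by
  have h1 := coeff_pearsonOp_Dq_eq_sum hq0 hq1 𝔞 𝔟 𝔠 β hf i
  have hX : ∀ j, (X ^ j : ℂ[X]).natDegree ≤ j := natDegree_X_pow_le
  rw [h, coeff_C_mul, Finset.range_eq_Ico, ← Finset.sum_Ico_consecutive _ (Nat.zero_le (i + 1))
    (by omega), ← Finset.range_eq_Ico, Finset.sum_range_succ, Finset.sum_eq_zero, zero_add,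
    (coeff_pearsonOp_Dq hq0 hq1 𝔞 𝔟 𝔠 β (hX i)).2, coeff_X_pow_self] at h1
  · linear_combination h1
  · intro j hj
    rw [(coeff_pearsonOp_Dq hq0 hq1 𝔞 𝔟 𝔠 β (hX j)).1 i (Finset.mem_range.1 hj), mul_zero]

omit hq0 hq1 in
theorem tendsto_coeff_pearsonOp {𝔞s 𝔟s 𝔠s βs : ℕ → ℂ} {𝔞 𝔟 𝔠 β : ℂ}
    (h𝔞 : Tendsto 𝔞s atTop (𝓝 𝔞)) (h𝔟 : Tendsto 𝔟s atTop (𝓝 𝔟)) (h𝔠 : Tendsto 𝔠s atTop (𝓝 𝔠))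
    (hβ : Tendsto βs atTop (𝓝 β)) (f : ℂ[X]) (i : ℕ) :
    Tendsto (fun k => (pearsonOp q (𝔞s k) (𝔟s k) (𝔠s k) (βs k) f).coeff i) atTop
      (𝓝 ((pearsonOp q 𝔞 𝔟 𝔠 β f).coeff i)) := by
  have e : ∀ 𝔞 𝔟 𝔠 β : ℂ, (pearsonOp q 𝔞 𝔟 𝔠 β f).coeff i = 𝔞 * (X ^ 2 * Dq q f).coeff i +
      𝔟 * (X * Dq q f).coeff i + 𝔠 * (Dq q f).coeff i + (X * Sq q f).coeff i -
      β * (Sq q f).coeff i := fun 𝔞 𝔟 𝔠 β => by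
    simp only [pearsonOp, add_mul, sub_mul, mul_assoc, coeff_add, coeff_sub, coeff_C_mul]
    ring
  simp only [e]
  exact ((((h𝔞.mul_const _).add (h𝔟.mul_const _)).add (h𝔠.mul_const _)).add_const _).sub
    (hβ.mul_const _)

/-- Monic eigenpolynomials depend continuously on the coefficients of the equation, as long as
the eigenvalues are distinct. -/
theorem tendsto_coeff_eigenpoly {𝔞s 𝔟s 𝔠s βs : ℕ → ℂ} {𝔞 𝔟 𝔠 β : ℂ}
    (h𝔞 : Tendsto 𝔞s atTop (𝓝 𝔞)) (h𝔟 : Tendsto 𝔟s atTop (𝓝 𝔟)) (h𝔠 : Tendsto 𝔠s atTop (𝓝 𝔠))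
    (hβ : Tendsto βs atTop (𝓝 β)) {n : ℕ} {Q : ℕ → ℂ[X]} {R : ℂ[X]}
    (hQn : ∀ k, (Q k).natDegree ≤ n) (hQc : ∀ k, (Q k).coeff n = 1)
    (hQ : ∀ k, pearsonOp q (𝔞s k) (𝔟s k) (𝔠s k) (βs k) (Dq q (Q k)) =
      C (eigenNum q (𝔞s k) n) * Q k)
    (hRn : R.natDegree ≤ n) (hRc : R.coeff n = 1)
    (hR : pearsonOp q 𝔞 𝔟 𝔠 β (Dq q R) = C (eigenNum q 𝔞 n) * R)
    (hne : ∀ m < n, eigenNum q 𝔞 n - eigenNum q 𝔞 m ≠ 0) (i : ℕ) :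
    Tendsto (fun k => (Q k).coeff i) atTop (𝓝 (R.coeff i)) := by
  have hlam : ∀ m, Tendsto (fun k => eigenNum q (𝔞s k) m) atTop (𝓝 (eigenNum q 𝔞 m)) :=
    fun m => ((h𝔞.mul_const _).add_const _).const_mul _
  -- Descending induction from the leading coefficient: each coefficient is determined by the higher
  -- ones, and `d` bounds the distance below `n`.
  suffices H : ∀ d i, n ≤ i + d → Tendsto (fun k => (Q k).coeff i) atTop (𝓝 (R.coeff i)) from
    H n i (by omega)
  intro d
  induction d with
  | zero =>
    intro i hi
    rcases (show n ≤ i from hi).eq_or_lt with rfl | hi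
    · simp only [hQc, hRc]
      exact tendsto_const_nhds
    · have : ∀ k, (Q k).coeff i = 0 := fun k => coeff_eq_zero_of_natDegree_lt ((hQn k).trans_lt hi)
      simp only [this, coeff_eq_zero_of_natDegree_lt (hRn.trans_lt hi)]
      exact tendsto_const_nhds
  | succ d ih =>
    intro i hi
    rcases le_or_gt n i with hni | hni
    · exact ih i (by omega)
    have hsub := (hlam n).sub (hlam i)
    have hlim : Tendsto (fun k => (∑ j ∈ Finset.Ico (i + 1) (n + 1), (Q k).coeff j *
        (pearsonOp q (𝔞s k) (𝔟s k) (𝔠s k) (βs k) (Dq q (X ^ j))).coeff i) /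
        (eigenNum q (𝔞s k) n - eigenNum q (𝔞s k) i)) atTop (𝓝 ((∑ j ∈ Finset.Ico (i + 1) (n + 1),
        R.coeff j * (pearsonOp q 𝔞 𝔟 𝔠 β (Dq q (X ^ j))).coeff i) /
        (eigenNum q 𝔞 n - eigenNum q 𝔞 i))) := by
      refine (tendsto_finsetSum _ fun j hj => ?_).div hsub (hne i hni)
      have hj := Finset.mem_Ico.1 hj
      exact (ih j (by omega)).mul (tendsto_coeff_pearsonOp h𝔞 h𝔟 h𝔠 hβ _ _)
    rw [← eigenpoly_coeff hq0 hq1 hRn hR hni, mul_div_cancel_left₀ _ (hne i hni)] at hlim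
    -- The quotient formula is valid only eventually, once the approximating eigenvalues are
    -- distinct.
    refine hlim.congr' ?_
    filter_upwards [hsub.eventually_ne (hne i hni)] with k hk
    rw [← eigenpoly_coeff hq0 hq1 (hQn k) (hQ k) hni, mul_div_cancel_left₀ _ hk]

end Limit

/-! ### Density of the equations that come from admissible parameters. -/

section Parameters

open Filter Topology

theorem countable_zeros {p : ℂ[X]} (hp : p ≠ 0) : {z : ℂ | p.eval z = 0}.Countable := by
  have : {z : ℂ | p.eval z = 0} = {z : ℂ | p.IsRoot z} := rfl
  rw [this]
  exact (finite_setOfPred_isRoot hp).countable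

/-- Under a common translation by `z`, each restriction is the nonvanishing of a nonzero polynomial
in `z`, and there are countably many restrictions. Arbitrarily small `z` therefore restore
admissibility. -/
theorem countable_not_admissible (q t₁ t₂ t₃ t₄ : ℂ) :
    {z : ℂ | ¬AdmissibleParams q (t₁ + z) (t₂ + z) (t₃ + z) (t₄ + z)}.Countable := by
  have hpair : ∀ (a b : ℂ) (n : ℕ), {z : ℂ | 1 - (a + z) * (b + z) * q ^ n = 0}.Countable := by
    intro a b n
    have hp : (1 - (C a + X) * (C b + X) * C (q ^ n) : ℂ[X]) ≠ 0 := fun h => by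
      have := congrArg (eval (-a)) h
      simp at this
    refine (countable_zeros hp).mono fun z hz => ?_
    simpa using hz
  have hquad : ∀ n : ℕ, {z : ℂ |
      1 - (t₁ + z) * (t₂ + z) * (t₃ + z) * (t₄ + z) * q ^ n = 0}.Countable := by
    intro n
    have hp : (1 - (C t₁ + X) * (C t₂ + X) * (C t₃ + X) * (C t₄ + X) * C (q ^ n) : ℂ[X]) ≠ 0 :=
      fun h => by
        have := congrArg (eval (-t₁)) h
        simp at this
    refine (countable_zeros hp).mono fun z hz => ?_
    simpa using hz
  refine ((Set.countable_singleton (-t₁)).union (Set.countable_iUnion fun n =>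
    (((((((hquad n).union (hpair t₁ t₂ n)).union (hpair t₁ t₃ n)).union (hpair t₁ t₄ n)).union
      (hpair t₂ t₃ n)).union (hpair t₂ t₄ n)).union (hpair t₃ t₄ n)))).mono fun z hz => ?_
  simp only [Set.mem_ofPred_eq, AdmissibleParams, not_and_or, not_forall, not_not, mul_eq_zero] at hz
  rcases hz with hz | ⟨n, hz⟩
  · left
    rw [Set.mem_singleton_iff]
    linear_combination hz
  · right
    rw [Set.mem_iUnion]
    exact ⟨n, hz⟩

theorem exists_symmetric_functions (e₁ e₂ e₃ e₄ : ℂ) : ∃ t₁ t₂ t₃ t₄ : ℂ,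
    t₁ + t₂ + t₃ + t₄ = e₁ ∧ t₁ * t₂ + t₁ * t₃ + t₁ * t₄ + t₂ * t₃ + t₂ * t₄ + t₃ * t₄ = e₂ ∧
      t₁ * t₂ * t₃ + t₁ * t₂ * t₄ + t₁ * t₃ * t₄ + t₂ * t₃ * t₄ = e₃ ∧
        t₁ * t₂ * t₃ * t₄ = e₄ := by
  have hroot : ∀ p : ℂ[X], p.natDegree ≠ 0 → ∃ t, p.eval t = 0 := fun p hp =>
    IsAlgClosed.exists_root p fun h => hp (natDegree_eq_of_degree_eq_some h)
  obtain ⟨t₁, h₁⟩ := hroot (X ^ 4 - C e₁ * X ^ 3 + C e₂ * X ^ 2 - C e₃ * X + C e₄) (by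
    have : (X ^ 4 - C e₁ * X ^ 3 + C e₂ * X ^ 2 - C e₃ * X + C e₄ : ℂ[X]).natDegree = 4 := by
      compute_degree!
    omega)
  -- The coefficients are those of the quotient of the previous polynomial by `X - t₁`; the next
  -- step divides again, by `X - t₂`.
  obtain ⟨t₂, h₂⟩ := hroot (X ^ 3 - C (e₁ - t₁) * X ^ 2 + C (e₂ - t₁ * (e₁ - t₁)) * X -
      C (e₃ - t₁ * (e₂ - t₁ * (e₁ - t₁)))) (by
    have : (X ^ 3 - C (e₁ - t₁) * X ^ 2 + C (e₂ - t₁ * (e₁ - t₁)) * X -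
      C (e₃ - t₁ * (e₂ - t₁ * (e₁ - t₁))) : ℂ[X]).natDegree = 3 := by
      compute_degree!
    omega)
  obtain ⟨t₃, h₃⟩ := hroot (X ^ 2 - C (e₁ - t₁ - t₂) * X +
      C (e₂ - t₁ * (e₁ - t₁) - t₂ * (e₁ - t₁ - t₂))) (by
    have : (X ^ 2 - C (e₁ - t₁ - t₂) * X +
      C (e₂ - t₁ * (e₁ - t₁) - t₂ * (e₁ - t₁ - t₂)) : ℂ[X]).natDegree = 2 := by
      compute_degree!
    omega)
  simp only [eval_add, eval_sub, eval_mul, eval_C, eval_X, eval_pow] at h₁ h₂ h₃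
  refine ⟨t₁, t₂, t₃, e₁ - t₁ - t₂ - t₃, by ring, ?_, ?_, ?_⟩
  · linear_combination -h₃
  · linear_combination h₂ - (t₁ + t₂) * h₃
  · linear_combination -h₁ + t₁ * h₂ - t₁ * t₂ * h₃

variable {q : ℝ} (hq0 : 0 < q) (hq1 : q < 1)
include hq0 hq1

/-- Every second-order equation is a limit of equations of Askey-Wilson polynomials with
admissible parameters. -/
theorem mem_closure_paramRel (v : ℂ × ℂ × ℂ × ℂ) :
    v ∈ closure {v : ℂ × ℂ × ℂ × ℂ | ∃ t₁ t₂ t₃ t₄ : ℂ, AdmissibleParams (q : ℂ) t₁ t₂ t₃ t₄ ∧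
      ParamRel q v.1 v.2.1 v.2.2.1 v.2.2.2 t₁ t₂ t₃ t₄} := by
  have hκ := qPow_half_sub_inv_ne_zero hq0 hq1
  set A := {v : ℂ × ℂ × ℂ × ℂ | ∃ t₁ t₂ t₃ t₄ : ℂ, AdmissibleParams (q : ℂ) t₁ t₂ t₃ t₄ ∧
      ParamRel q v.1 v.2.1 v.2.2.1 v.2.2.2 t₁ t₂ t₃ t₄} with hA
  set κ := qPow q (1 / 2) - (qPow q (1 / 2))⁻¹ with hκdef
  have hgen : ∀ 𝔞 𝔟 𝔠 β : ℂ, 𝔞 ≠ κ / 2 → (𝔞, 𝔟, 𝔠, β) ∈ closure A := by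
    intro 𝔞 𝔟 𝔠 β h𝔞
    have hK : 𝔞 - κ / 2 ≠ 0 := sub_ne_zero.2 h𝔞
    -- Subtracting `K (e₄ - 1) = κ` from `2𝔞 = K (e₄ + 1)` gives this `K`. As `K ≠ 0`, the relations
    -- of `ParamRel` can be solved for the elementary symmetric functions of the parameters.
    obtain ⟨K, hKdef⟩ : ∃ K, K = 𝔞 - κ / 2 := ⟨_, rfl⟩
    rw [← hKdef] at hK
    obtain ⟨t₁, t₂, t₃, t₄, h₁, h₂, h₃, h₄⟩ := exists_symmetric_functions
      (-(2 * 𝔟 + κ * β) / K) ((2 * 𝔞 + 4 * 𝔠) / K) (-(2 * 𝔟 - κ * β) / K) ((𝔞 + κ / 2) / K)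
    let e₄ : ℂ → ℂ := fun z => (t₁ + z) * (t₂ + z) * (t₃ + z) * (t₄ + z)
    let e₃ : ℂ → ℂ := fun z => (t₁ + z) * (t₂ + z) * (t₃ + z) + (t₁ + z) * (t₂ + z) * (t₄ + z) +
      (t₁ + z) * (t₃ + z) * (t₄ + z) + (t₂ + z) * (t₃ + z) * (t₄ + z)
    let e₂ : ℂ → ℂ := fun z => (t₁ + z) * (t₂ + z) + (t₁ + z) * (t₃ + z) + (t₁ + z) * (t₄ + z) +
      (t₂ + z) * (t₃ + z) + (t₂ + z) * (t₄ + z) + (t₃ + z) * (t₄ + z)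
    let e₁ : ℂ → ℂ := fun z => (t₁ + z) + (t₂ + z) + (t₃ + z) + (t₄ + z)
    have hz₄ : e₄ 0 = (𝔞 + κ / 2) / K := by simp only [e₄, add_zero, h₄]
    have hz₃ : e₃ 0 = -(2 * 𝔟 - κ * β) / K := by simp only [e₃, add_zero, h₃]
    have hz₂ : e₂ 0 = (2 * 𝔞 + 4 * 𝔠) / K := by simp only [e₂, add_zero, h₂]
    have hz₁ : e₁ 0 = -(2 * 𝔟 + κ * β) / K := by simp only [e₁, add_zero, h₁]
    have c₄ : Continuous e₄ := by fun_prop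
    have c₃ : Continuous e₃ := by fun_prop
    have c₂ : Continuous e₂ := by fun_prop
    have c₁ : Continuous e₁ := by fun_prop
    have hsub : e₄ 0 - 1 = κ / K := by
      have h𝔞K : 𝔞 = K + κ / 2 := by rw [hKdef, sub_add_cancel]
      rw [hz₄, h𝔞K]
      field_simp
      ring
    have hsub0 : e₄ 0 - 1 ≠ 0 := by
      rw [hsub]
      exact div_ne_zero hκ hK
    let k : ℂ → ℂ := fun z => κ / (e₄ z - 1)
    have hk0 : k 0 = K := by
      simp only [k]
      rw [hsub]
      field_simp
    have ck : ContinuousAt k 0 := continuousAt_const.div (c₄.continuousAt.sub continuousAt_const) hsub0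
    let F : ℂ → ℂ × ℂ × ℂ × ℂ := fun z => (k z * (e₄ z + 1) / 2, -(k z * (e₁ z + e₃ z)) / 4,
      k z * (e₂ z - e₄ z - 1) / 4, k z * (e₃ z - e₁ z) / (2 * κ))
    have hF0 : F 0 = (𝔞, 𝔟, 𝔠, β) := by
      simp only [F, hk0, hz₁, hz₂, hz₃, hz₄, Prod.mk.injEq]
      refine ⟨?_, ?_, ?_, ?_⟩
      · field_simp
        rw [hKdef]
        ring
      · field_simp
        ring
      · field_simp
        rw [hKdef]
        ring
      · field_simp
        ring
    have cF : ContinuousAt F 0 := by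
      have d₁ := c₁.continuousAt (x := 0)
      have d₂ := c₂.continuousAt (x := 0)
      have d₃ := c₃.continuousAt (x := 0)
      have d₄ := c₄.continuousAt (x := 0)
      refine ContinuousAt.prodMk ((ck.mul (d₄.add continuousAt_const)).div_const _)
        (ContinuousAt.prodMk ((ck.mul (d₁.add d₃)).neg.div_const _) (ContinuousAt.prodMk
          ((ck.mul ((d₂.sub d₄).sub continuousAt_const)).div_const _)
          ((ck.mul (d₃.sub d₁)).div_const _)))
    have hdense := ((countable_not_admissible (q : ℂ) t₁ t₂ t₃ t₄).dense_compl ℝ) 0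
    have hev : ∀ᶠ z in 𝓝 (0 : ℂ), e₄ z - 1 ≠ 0 :=
      (c₄.continuousAt.sub continuousAt_const).eventually_ne hsub0
    rw [← hF0, mem_closure_iff_frequently]
    refine cF.frequently ?_
    refine ((mem_closure_iff_frequently.1 hdense).and_eventually hev).mono fun z hz => ?_
    have hadm : AdmissibleParams (q : ℂ) (t₁ + z) (t₂ + z) (t₃ + z) (t₄ + z) := not_not.1 hz.1
    have hz := hz.2
    have hkz : k z * (e₄ z - 1) = κ := div_mul_cancel₀ _ hz
    refine ⟨_, _, _, _, hadm, k z, hkz, ?_, ?_, ?_, ?_⟩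
    · change 2 * (k z * (e₄ z + 1) / 2) = k z * (e₄ z + 1)
      ring
    · change 4 * (-(k z * (e₁ z + e₃ z)) / 4) = -(k z * (e₁ z + e₃ z))
      ring
    · change 4 * (k z * (e₂ z - e₄ z - 1) / 4) = k z * (e₂ z - e₄ z - 1)
      ring
    · change 2 * κ * (k z * (e₃ z - e₁ z) / (2 * κ)) = k z * (e₃ z - e₁ z)
      field_simp
  obtain ⟨𝔞, 𝔟, 𝔠, β⟩ := v
  -- The excluded value `𝔞 = κ / 2` is reached by varying `𝔞` alone, at the cost of a second
  -- closure.
  rw [← closure_closure, mem_closure_iff_frequently]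
  have hc : ContinuousAt (fun z : ℂ => (z, 𝔟, 𝔠, β)) 𝔞 := by fun_prop
  refine hc.frequently (((mem_closure_iff_frequently.1 ((dense_compl_singleton (κ / 2)) 𝔞))).mono
    fun z hz => hgen z 𝔟 𝔠 β hz)

/-- A sequence of monic eigenpolynomials with distinct eigenvalues is a limit of sequences of
Askey-Wilson polynomials. -/
theorem isAskeyWilsonOrLimit_of_eigen {P : ℕ → ℂ[X]} {𝔞 𝔟 𝔠 β : ℂ}
    (hdeg : ∀ n, (P n).natDegree ≤ n) (hlead : ∀ n, (P n).coeff n = 1)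
    (heig : ∀ n, pearsonOp q 𝔞 𝔟 𝔠 β (Dq q (P n)) = C (eigenNum q 𝔞 n) * P n)
    (hne : ∀ m n, m < n → eigenNum q 𝔞 n - eigenNum q 𝔞 m ≠ 0) :
    IsAskeyWilsonOrLimit q P := by
  obtain ⟨x, hx, hlim⟩ := mem_closure_iff_seq_limit.1 (mem_closure_paramRel hq0 hq1 (𝔞, 𝔟, 𝔠, β))
  choose t₁ t₂ t₃ t₄ hadm hrel using hx
  refine ⟨t₁, t₂, t₃, t₄, hadm, fun n i => ?_⟩
  have l₁ := hlim.fst_nhds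
  have l₂ := hlim.snd_nhds
  exact tendsto_coeff_eigenpoly hq0 hq1 l₁ l₂.fst_nhds l₂.snd_nhds.fst_nhds l₂.snd_nhds.snd_nhds
    (fun k => natDegree_askeyWilsonPoly_le n)
    (fun k => coeff_askeyWilsonPoly hq0 hq1 (hadm k) n)
    (fun k => pearsonOp_Dq_askeyWilsonPoly hq0 hq1 (hadm k) (hrel k) n)
    (hdeg n) (hlead n) (heig n) (fun m hm => hne m n hm) i

end Parameters

end AskeyWilson

/-! ### The main theorem. -/

theorem mainTheorem1
    (q : ℝ) (hq0 : 0 < q) (hq1 : q < 1)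
    (u : ℂ[X] →ₗ[ℂ] ℂ) (P : ℕ → ℂ[X]) (hP : IsMonicOPS u P)
    -- the structure relation
    (a b c : ℂ) (an bn cn : ℕ → ℂ) (hcn : ∀ n, cn n ≠ 0)
    (hrel : ∀ n, (C a * X ^ 2 + C b * X + C c) * Dq q (P n) =
      C (an n) * Sq q (P (n + 1)) + C (bn n) * Sq q (P n) + C (cn n) * Sq q (prev P n))
    -- notation: the coefficients in `P (n+1) = (z - B n) P n - Γ n P (n-1)`, and `α`, `r`
    (B Γ r : ℕ → ℂ) (α : ℂ)
    (hB : B = recB u P) (hΓ : Γ = recC u P)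
    (hr : r = fun i => cn i + 2 * a * Γ i) (hα : α = alphaNum q 1)
    -- the two compatibility conditions
    (hcond1 : a ≠ 0 →
      (4 * α ^ 2 - 1) * a * Γ 2 * Γ 3 +
        r 3 / 2 * ((B 0 + B 1) ^ 2 + 4 * α ^ 2 * (Γ 1 - B 0 * B 1 + α ^ 2 - 1)
          - 2 * (2 * α ^ 2 - 1) * Γ 2) = 0)
    (hcond2 :
      a * Γ 2 * Γ 3 * (bn 2 + 2 * a * B 2 + b / α)
        - r 3 * (a * (B 2 + B 1) * Γ 2 + b / α * Γ 2 - r 2 / 2 * (B 1 - B 0)) = 0)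
    -- the coefficients of `φ`
    (𝔞 𝔟 𝔠 : ℂ)
    (h𝔞 : 𝔞 = -((a * Γ 3 + (α ^ 2 - 1) * r 3) / (α * r 3)))
    (h𝔟 : 𝔟 = -(1 / (2 * α)) * ((1 - 2 * a * (Γ 3 / r 3)) * (B 0 + B 1) - 2 * α ^ 2 * B 0))
    (h𝔠 : 𝔠 = -(1 / (2 * α)) *
      ((1 - 2 * a * (Γ 3 / r 3)) * (Γ 1 - B 0 * B 1) + Γ 1 + B 0 ^ 2)) :
    IsAskeyWilsonOrLimit q P ∧
    -- the denominator `r 3` of the coefficients does not vanish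
    r 3 ≠ 0 ∧
    ∀ n : ℕ,
      (C 𝔞 * X ^ 2 + C 𝔟 * X + C 𝔠) * Dq q (Dq q (P n))
        + (X - C (B 0)) * Sq q (Dq q (P n)) =
      C (gammaNum q n * (𝔞 * gammaNum q ((n : ℤ) - 1) + alphaNum q ((n : ℤ) - 1))) * P n := by
  subst hB hΓ hr hα
  have hu := pearson_of_compatibility hq0 hq1 hP hcn hcond1 hrel hcond2 h𝔞 h𝔟 h𝔠
  have heig := pearsonOp_Dq_eq hq0 hq1 hu hP
  refine ⟨isAskeyWilsonOrLimit_of_eigen hq0 hq1 (fun n => (hP.natDegree_eq n).le) hP.coeff_self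
    heig fun m n hmn => eigenNum_ne hq0 hq1 (admissible_of_pearsonOp hq0 hq1 hu hP) hmn,
    structure_denom_ne_zero hq0 hq1 hP hcn hcond1, heig⟩
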